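/- Let $\mathbf p=(p_1,\dots,p_k)$ be a probability distribution, $C(\mathbf p)=\sum_i p_i^2$ its collision probability, and $c_0\in\mathbb R$. Let $\alpha>0$, $\beta,\delta\in(0,1]$. **Mechanism.** Put $r=\big\lceil 6\big(\frac{e^\alpha+1}{e^\alpha-1}\big)^2\log\frac4\beta\big\rceil$. A run of the mechanism with expected number of users $n$, precision $w\in(0,1]$ and failure probability $\delta'\in(0,1)$ uses $a=\lceil 8\log\frac1{\delta'}\rceil$ supergroups of $b=\lceil 20/w^2\rceil$ groups each, $g=ab$, $m=n/g$. The server draws independent group sizes $N_j\sim\mathrm{Poisson}(m)$, $1\le j\le g$, assigns users to the groups, and sends them a uniformly random hash function $h$ with values in $\{-1,+1\}$. A user of group $j$ with sample $x$ privately chooses a uniform salt $s\in\{1,\dots,r\}$ and sends $h(j,s,x)$. With $V_j$ the sum of the hash values of group $j$ and $C_j=r(V_j^2-m)/m^2$, the estimate $\hat C$ is the median over the supergroups of the mean of the $C_j$ in the supergroup. **Doubling Tester.** In rounds $t=0,1,2,\dots$ run the mechanism with fresh users and fresh independent randomness, with $\delta_t=\delta/2^{t+1}$, $a_t=\lceil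 8\log\frac1{\delta_t}\rceil$, $n_t=160\,a_0\,r\,2^t$ and $w_t=\sqrt{160\,a_t\,r/n_t}$; let $\hat C_t$ be its estimate. Reject the null hypothesis and stop as soon as $|\hat C_t-c_0|>w_t$. All users' samples are drawn independently from $\mathbf p$. **Theorem.** 1. The Doubling Tester is $(\alpha,\beta)$-locally differentially private: if $x,x'$ are two assignments of samples to the users $0,1,2,\dots$ that differ only in the sample of one user, then for every measurable set $\mathcal O$ of transcripts (the group sizes, hash functions and hash values of all rounds that are run, and the information which rounds are run), $\Pr[M(x)\in\mathcal O]\le e^\alpha\Pr[M(x')\in\mathcal O]+\beta$. 2. If $C(\mathbf p)=c_0$, then with probability at least $1-\delta$ the Doubling Tester never rejects. 3. For every $\kappa\in(0,1)$ there is a constant $K>0$, depending on $\kappa$ only, such that whenever $\beta,\delta\in(0,\kappa]$, $\varepsilon\in(0,\kappa]$ and $|C(\mathbf p)-c_0|\ge\varepsilon$, the Doubling Tester, with probability at least $1-\delta$, rejects after observing at most $$K\Big(\frac{e^\alpha+1}{e^\alpha-1}\Big)^2\,\frac{\log^2\frac1\varepsilon\,\log\frac1\beta\,\log\frac1\delta}{\varepsilon^2}$$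 samples, and if $\alpha\le1$, also with probability at least $1-\delta$, it rejects after observing at most $K\,\frac{\log^2\frac1\varepsilon\,\log\frac1\beta\,\log\frac1\delta}{\alpha^2\varepsilon^2}$ samples. -/

import Mathlib

open MeasureTheory ProbabilityTheory

namespace CollisionTest

noncomputable section

/-- The collision probability `C(p) = ∑ i, p i ^ 2`. -/
def collisionProb {k : ℕ} (p : PMF (Fin k)) : ℝ := ∑ i, (p i).toReal ^ 2

/-- The median of `f 0, …, f (a - 1)`: the middle entry of the sorted list, and the average of
the two middle entries when `a` is even. -/
def median (a : ℕ) (f : ℕ → ℝ) : ℝ :=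
  let L := ((List.range a).map f).insertionSort (· ≤ ·)
  (L.getD ((a - 1) / 2) 0 + L.getD (a / 2) 0) / 2

/-- Local differential privacy of a randomized interactive protocol `M` whose internal randomness
has law `μ`, for a population of users `0, 1, 2, …`; user `i` holds the sample `x i`. The output
`M x ω` is the whole communication transcript. Changing the sample of one user changes the
probability of any event about the transcript by at most a factor `exp α` and a summand `β`. -/
def IsLDP {Ω X T : Type*} [MeasurableSpace Ω] [MeasurableSpace T]
    (α β : ℝ) (μ : Measure Ω) (M : (ℕ → X) → Ω → T) : Prop :=
  ∀ (i : ℕ) (x x' : ℕ → X), (∀ j, j ≠ i → x' j = x j) →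
    ∀ O : Set T, MeasurableSet O →
      μ {ω | M x ω ∈ O} ≤
        ENNReal.ofReal (Real.exp α) * μ {ω | M x' ω ∈ O} + ENNReal.ofReal β

/-! ### One run of the hashing mechanism -/

/-- The number `r` of salts, `6 ((e^α + 1) / (e^α - 1))² log (4 / β)` rounded up (for `α > 0` and
`0 < β ≤ 1` the maximum with `1` has no effect). -/
def numSalts (α β : ℝ) : ℕ :=
  max 1 ⌈6 * ((Real.exp α + 1) / (Real.exp α - 1)) ^ 2 * Real.log (4 / β)⌉₊

instance (α β : ℝ) : NeZero (numSalts α β) :=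
  ⟨Nat.one_le_iff_ne_zero.mp (le_max_left _ _)⟩

/-- The number `a` of supergroups for failure probability `δ`. -/
def numSupergroups (δ : ℝ) : ℕ := ⌈8 * Real.log (1 / δ)⌉₊

/-- The number `b` of groups in each supergroup for precision parameter `w`. -/
def groupsPerSupergroup (w : ℝ) : ℕ := ⌈20 / w ^ 2⌉₊

/-- A hash function, applied to triples (group index, salt, sample). -/
abbrev Hash (r k : ℕ) : Type := ℕ × Fin r × Fin k → ℤˣ

/-- The transcript of one run: the group sizes (which tell each user the assigned group), the hash
function sent by the server, and the hash values sent by the users; the value at `(j, i)` is that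
of the `i`-th user of group `j`, and it is `1` by convention if there is no such user. -/
abbrev RunTranscript (r k : ℕ) : Type := (ℕ → ℕ) × Hash r k × (ℕ × ℕ → ℤˣ)

/-- Users are assigned to groups consecutively: the number of the `i`-th user of group `j`. -/
def member (N : ℕ → ℕ) (j i : ℕ) : ℕ := (∑ l ∈ Finset.range j, N l) + i

/-- The transcript of a run with `g` groups of sizes `N 0, …, N (g - 1)`, hash function `h`, where
the user with number `u` has salt `s u` and sample `x u`: this user sends `h (j, s u, x u)`, with
`j` the assigned group. -/
def runTranscript {r k : ℕ} (g : ℕ) (N : ℕ → ℕ) (h : Hash r k) (s : ℕ → Fin r) (x : ℕ → Fin k) :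
    RunTranscript r k :=
  (fun j => if j < g then N j else 0, h,
    fun q => if q.1 < g ∧ q.2 < N q.1 then h (q.1, s (member N q.1 q.2), x (member N q.1 q.2))
      else 1)

/-- The sum `V j` of the hash values of group `j`. -/
def groupSum {r k : ℕ} (T : RunTranscript r k) (j : ℕ) : ℝ :=
  ∑ i ∈ Finset.range (T.1 j), ((T.2.2 (j, i) : ℤ) : ℝ)

/-- The bias-corrected estimate `C j = r (V j ^ 2 - m) / m ^ 2` of group `j`, where `m` is the
expected group size. -/
def groupEstimate {r k : ℕ} (m : ℝ) (T : RunTranscript r k) (j : ℕ) : ℝ :=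
  r * (groupSum T j ^ 2 - m) / m ^ 2

/-- The estimate which the server computes from the transcript: the median over the `a`
supergroups of the mean of the estimates of the `b` groups in the supergroup. -/
def estimate {r k : ℕ} (a b : ℕ) (m : ℝ) (T : RunTranscript r k) : ℝ :=
  median a fun l => (1 / (b : ℝ)) * ∑ j ∈ Finset.range b, groupEstimate m T (l * b + j)

/-! ### The Doubling Tester

Round `t = 0, 1, 2, …` is a run of the mechanism on fresh users, with fresh randomness, with
expected number of users `sampleSize t`, failure probability `failProb t` and precision
`radius t`. The tester rejects at the end of the first round where the estimate is further than
`radius t` from `c₀`. -/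

/-- The failure probability `δ / 2 ^ (t + 1)` allotted to round `t`; these sum to `δ`. -/
def failProb (δ : ℝ) (t : ℕ) : ℝ := δ / 2 ^ (t + 1)

/-- The expected number of users in round `t`; it doubles from each round to the next. -/
def sampleSize (α β δ : ℝ) (t : ℕ) : ℝ :=
  160 * numSupergroups (failProb δ 0) * numSalts α β * 2 ^ t

/-- The half-width of the confidence interval of round `t`, `√(160 a r / n)`. -/
def radius (α β δ : ℝ) (t : ℕ) : ℝ :=
  Real.sqrt (160 * numSupergroups (failProb δ t) * numSalts α β / sampleSize α β δ t)

/-- The number `a` of supergroups in round `t`. -/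
def roundSupergroups (δ : ℝ) (t : ℕ) : ℕ := numSupergroups (failProb δ t)

/-- The number `b` of groups per supergroup in round `t`. -/
def roundGroupsPer (α β δ : ℝ) (t : ℕ) : ℕ := groupsPerSupergroup (radius α β δ t)

/-- The number `g = a b` of groups in round `t`. -/
def roundGroups (α β δ : ℝ) (t : ℕ) : ℕ := roundSupergroups δ t * roundGroupsPer α β δ t

/-- The expected group size `m = n / g` in round `t`. -/
def roundRate (α β δ : ℝ) (t : ℕ) : ℝ := sampleSize α β δ t / roundGroups α β δ t

/-- The internal randomness of the tester: the size of group `j` in round `t`, the hash function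
of round `t`, and the salt of user `u`. -/
abbrev Seed (r k : ℕ) : Type :=
  (ℕ × ℕ → ℕ) × (ℕ × ℕ × Fin r × Fin k → ℤˣ) × (ℕ → Fin r)

/-- Group sizes are Poisson, hash values of distinct arguments are uniform signs, salts are
uniform, and all these are independent. -/
def seedLaw (k : ℕ) (α β δ : ℝ) : Measure (Seed (numSalts α β) k) :=
  (Measure.infinitePi fun q : ℕ × ℕ => poissonMeasure (roundRate α β δ q.1).toNNReal).prod
    ((Measure.infinitePi fun _ : ℕ × ℕ × Fin (numSalts α β) × Fin k =>
        uniformOn (Set.univ : Set ℤˣ)).prod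
      (Measure.infinitePi fun _ : ℕ => uniformOn (Set.univ : Set (Fin (numSalts α β)))))

instance (k : ℕ) (α β δ : ℝ) : IsProbabilityMeasure (seedLaw k α β δ) := by
  unfold seedLaw; infer_instance

/-- The joint law of the internal randomness and of the users' samples, which are drawn
independently from `p`. -/
def fullLaw {k : ℕ} (p : PMF (Fin k)) (α β δ : ℝ) :
    Measure (Seed (numSalts α β) k × (ℕ → Fin k)) :=
  (seedLaw k α β δ).prod (Measure.infinitePi fun _ : ℕ => p.toMeasure)

instance {k : ℕ} (p : PMF (Fin k)) (α β δ : ℝ) : IsProbabilityMeasure (fullLaw p α β δ) := by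
  unfold fullLaw; infer_instance

/-- The number of users who take part in the rounds before round `t`. -/
def usersBefore {k : ℕ} (α β δ : ℝ) (ω : Seed (numSalts α β) k) (t : ℕ) : ℕ :=
  ∑ u ∈ Finset.range t, ∑ j ∈ Finset.range (roundGroups α β δ u), ω.1 (u, j)

/-- The transcript of round `t`, if it is run: its users are those that follow the users of the
earlier rounds. -/
def roundTranscript {k : ℕ} (α β δ : ℝ) (x : ℕ → Fin k) (ω : Seed (numSalts α β) k) (t : ℕ) :
    RunTranscript (numSalts α β) k :=
  runTranscript (roundGroups α β δ t) (fun j => ω.1 (t, j)) (fun q => ω.2.1 (t, q))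
    (fun i => ω.2.2 (usersBefore α β δ ω t + i)) (fun i => x (usersBefore α β δ ω t + i))

/-- The estimate of the collision probability in round `t`. -/
def roundEstimate {k : ℕ} (α β δ : ℝ) (x : ℕ → Fin k) (ω : Seed (numSalts α β) k) (t : ℕ) : ℝ :=
  estimate (roundSupergroups δ t) (roundGroupsPer α β δ t) (roundRate α β δ t)
    (roundTranscript α β δ x ω t)

/-- The rejection criterion of round `t`. -/
def Exceeds {k : ℕ} (c₀ α β δ : ℝ) (x : ℕ → Fin k) (ω : Seed (numSalts α β) k) (t : ℕ) : Prop :=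
  radius α β δ t < |roundEstimate α β δ x ω t - c₀|

/-- The tester rejects the null hypothesis at the end of round `t`. -/
def RejectsAt {k : ℕ} (c₀ α β δ : ℝ) (x : ℕ → Fin k) (ω : Seed (numSalts α β) k) (t : ℕ) : Prop :=
  Exceeds c₀ α β δ x ω t ∧ ∀ u < t, ¬ Exceeds c₀ α β δ x ω u

/-- The tester rejects the null hypothesis after observing at most `B` samples. -/
def RejectsWithin {k : ℕ} (c₀ α β δ : ℝ) (B : ℝ) (x : ℕ → Fin k) (ω : Seed (numSalts α β) k) :
    Prop :=
  ∃ t, RejectsAt c₀ α β δ x ω t ∧ (usersBefore α β δ ω (t + 1) : ℝ) ≤ B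

open Classical in
/-- The transcript of the tester: the sequence of the transcripts of its rounds, where
`Sum.inl ()` stands for a round that is not run because the tester has stopped before. -/
def transcript {k : ℕ} (c₀ α β δ : ℝ) (x : ℕ → Fin k) (ω : Seed (numSalts α β) k) :
    ℕ → Unit ⊕ RunTranscript (numSalts α β) k :=
  fun t => if ∃ u < t, RejectsAt c₀ α β δ x ω u then Sum.inl ()
    else Sum.inr (roundTranscript α β δ x ω t)

end

end CollisionTest

/-!
Privacy. Fix the group sizes. User `i` then belongs to at most one group `j` of one round `t`, and
the salt and the sample of the user enter the transcript only through one hash value. By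
Hoeffding's inequality the hash values `h(t, j, s, y)`, `s = 1, …, r`, of a sample `y` are balanced
up to the fraction `(e^α - 1) / (e^α + 1)`, except with probability `β / 2`. If this holds for both
samples of the user, a sign is reported with probabilities whose ratio is at most `e^α`; the
exceptions cost `β` in total.

Correctness. Poissonization makes the group sums independent. Each of them is a Poisson number of
signs, independent given the hash function, whose second and fourth moments give an unbiased
estimate of the collision probability of variance at most `5`. Chebyshev's inequality on a
supergroup and a majority bound for the median show that round `t` errs by more than its radius
with probability at most `δ / 2^(t+1)`, and the failure probabilities sum to at most `δ`.

Sample size. The tester rejects at the latest in the first round whose radius is below `ε / 2`,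
unless that round fails. The number of users up to this round is Poisson, and by a Chernoff bound
it exceeds four times its mean with a probability that the same `δ` budget absorbs.
-/

namespace CollisionTest

open scoped NNReal

section ProductMeasures

section Family

variable {ι : Type*} {X Y : ι → Type*} {mX : ∀ i, MeasurableSpace (X i)}
  {mY : ∀ i, MeasurableSpace (Y i)} (μ : ∀ i, Measure (X i)) [∀ i, IsProbabilityMeasure (μ i)]
  (ν : ∀ i, Measure (Y i)) [∀ i, IsProbabilityMeasure (ν i)]

lemma lintegral_prod_infinitePi (s : Finset ι) {f : ∀ i, X i → ENNReal}
    (hf : ∀ i, Measurable (f i)) :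
    ∫⁻ ω, ∏ i ∈ s, f i (ω i) ∂Measure.infinitePi μ = ∏ i ∈ s, ∫⁻ y, f i y ∂μ i := by
  rw [lintegral_prod_eq_prod_lintegral_of_indepFun s (fun i (ω : ∀ i, X i) => f i (ω i))
    (iIndepFun_infinitePi hf) fun i => (hf i).comp (measurable_pi_apply i)]
  refine Finset.prod_congr rfl fun i _ => ?_
  rw [← Measure.infinitePi_map_eval μ i, lintegral_map (hf i) (measurable_pi_apply i)]

lemma integral_eval_infinitePi (i : ι) {f : X i → ℝ} (hf : Measurable f) :
    ∫ ω, f (ω i) ∂Measure.infinitePi μ = ∫ y, f y ∂μ i := by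
  rw [← Measure.infinitePi_map_eval μ i,
    integral_map (measurable_pi_apply i).aemeasurable hf.aestronglyMeasurable]

lemma infinitePi_prod_map_zip :
    ((Measure.infinitePi μ).prod (Measure.infinitePi ν)).map
      (fun z i => ((z.1 i, z.2 i) : X i × Y i)) = Measure.infinitePi fun i => (μ i).prod (ν i) := by
  have hzip : Measurable fun (z : (∀ i, X i) × (∀ i, Y i)) i => ((z.1 i, z.2 i) : X i × Y i) := by
    fun_prop
  refine Measure.eq_infinitePi _ fun s t ht => ?_
  have hbox : MeasurableSet (Set.pi (s : Set ι) t) := .pi s.countable_toSet fun i _ => ht i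
  calc _ = ∫⁻ a, Measure.infinitePi ν (Set.pi s fun i => Prod.mk (a i) ⁻¹' t i)
        ∂Measure.infinitePi μ := by
        rw [Measure.map_apply hzip hbox, Measure.prod_apply (hzip hbox)]
        rfl
    _ = ∫⁻ a, ∏ i ∈ s, ν i (Prod.mk (a i) ⁻¹' t i) ∂Measure.infinitePi μ :=
        lintegral_congr fun a =>
          Measure.infinitePi_pi ν fun i _ => measurable_prodMk_left (ht i)
    _ = ∏ i ∈ s, ∫⁻ y, ν i (Prod.mk y ⁻¹' t i) ∂μ i :=
        lintegral_prod_infinitePi μ s fun i => measurable_measure_prodMk_left (ht i)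
    _ = _ := Finset.prod_congr rfl fun i _ => (Measure.prod_apply (ht i)).symm

lemma infinitePi_map_update [DecidableEq ι] (i : ι) :
    ((Measure.infinitePi μ).prod (μ i)).map (fun z => Function.update z.1 i z.2) =
      Measure.infinitePi μ := by
  refine Measure.eq_infinitePi _ fun s t ht => ?_
  rw [Measure.map_apply measurable_update' (.pi s.countable_toSet fun i _ => ht i)]
  by_cases hi : i ∈ s
  · have : (fun z : (∀ i, X i) × X i => Function.update z.1 i z.2) ⁻¹' Set.pi (s : Set ι) t =
        Set.pi ((s.erase i : Finset ι) : Set ι) t ×ˢ t i := by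
      ext z
      simp only [Set.mem_preimage, Set.mem_pi, Finset.mem_coe, Set.mem_prod, Finset.mem_erase]
      refine ⟨fun h => ⟨fun j hj => ?_, by simpa using h i hi⟩, fun h j hj => ?_⟩
      · simpa [Function.update_of_ne hj.1] using h j hj.2
      · obtain rfl | hji := eq_or_ne j i
        · simpa using h.2
        · simpa [Function.update_of_ne hji] using h.1 j ⟨hji, hj⟩
    rw [this, Measure.prod_prod, Measure.infinitePi_pi _ (fun i _ => ht i), mul_comm,
      Finset.mul_prod_erase s (fun j => μ j (t j)) hi]
  · have : (fun z : (∀ i, X i) × X i => Function.update z.1 i z.2) ⁻¹' Set.pi (s : Set ι) t =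
        Set.pi (s : Set ι) t ×ˢ Set.univ := by
      ext z
      simp only [Set.mem_preimage, Set.mem_pi, Finset.mem_coe, Set.mem_prod, Set.mem_univ, and_true]
      refine forall₂_congr fun j hj => ?_
      rw [Function.update_of_ne (ne_of_mem_of_not_mem hj hi)]
    rw [this, Measure.prod_prod, Measure.infinitePi_pi _ (fun i _ => ht i), measure_univ, mul_one]

lemma infinitePi_apply_eq_lintegral_update [DecidableEq ι] (i : ι) {A : Set (∀ i, X i)}
    (hA : MeasurableSet A) :
    Measure.infinitePi μ A =
      ∫⁻ ω, μ i {y | Function.update ω i y ∈ A} ∂Measure.infinitePi μ := by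
  conv_lhs => rw [← infinitePi_map_update μ i]
  rw [Measure.map_apply measurable_update' hA, Measure.prod_apply (measurable_update' hA)]
  rfl

end Family

lemma measurable_eval_at {Ω ι X : Type*} [MeasurableSpace Ω] [Countable ι] [MeasurableSpace ι]
    [MeasurableSingletonClass ι] [MeasurableSpace X] {f : Ω → ι → X} (hf : Measurable f)
    {g : Ω → ι} (hg : Measurable g) : Measurable fun ω => f ω (g ω) :=
  (measurable_from_prod_countable_left fun i => measurable_pi_apply i :
    Measurable fun p : (ι → X) × ι => p.1 p.2).comp (hf.prodMk hg)

instance : DiscreteMeasurableSpace ℤˣ :=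
  have : MeasurableSingletonClass ℤˣ :=
    ⟨fun a => ⟨{(a : ℤ)}, trivial, by ext; simp [Units.ext_iff]⟩⟩
  inferInstance

lemma measure_prod_le_mul_add_lintegral {X Y : Type*} [MeasurableSpace X] [MeasurableSpace Y]
    {μ : Measure X} {ν : Measure Y} [SFinite ν] {c : ENNReal} {f : X → ENNReal}
    {S S' : Set (X × Y)} (hS : MeasurableSet S) (hS' : MeasurableSet S')
    (h : ∀ a, ν (Prod.mk a ⁻¹' S) ≤ c * ν (Prod.mk a ⁻¹' S') + f a) :
    μ.prod ν S ≤ c * μ.prod ν S' + ∫⁻ a, f a ∂μ := by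
  have hmeas := measurable_measure_prodMk_left (ν := ν) hS'
  rw [Measure.prod_apply hS, Measure.prod_apply hS', ← lintegral_const_mul _ hmeas,
    ← lintegral_add_left (hmeas.const_mul c)]
  exact lintegral_mono h

end ProductMeasures

section Moments

variable {Ω : Type*} [MeasurableSpace Ω] {μ : Measure Ω}

lemma integrable_of_abs_le [IsFiniteMeasure μ] {f : Ω → ℝ} (hf : Measurable f) {C : ℝ}
    (h : ∀ ω, |f ω| ≤ C) : Integrable f μ :=
  Integrable.of_bound hf.aestronglyMeasurable C (ae_of_all _ h)

lemma integrable_pow_mul_pow [IsFiniteMeasure μ] {A B : Ω → ℝ} (hA : Measurable A)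
    (hB : Measurable B) {C D : ℝ} (hC : ∀ ω, |A ω| ≤ C) (hD : ∀ ω, |B ω| ≤ D) (i j : ℕ) :
    Integrable (fun ω => A ω ^ i * B ω ^ j) μ := by
  refine integrable_of_abs_le (by fun_prop) (C := C ^ i * D ^ j) fun ω => ?_
  rw [abs_mul, abs_pow, abs_pow]
  have := (abs_nonneg (A ω)).trans (hC ω)
  gcongr
  · exact hC ω
  · exact hD ω

lemma integral_pow_mul_pow_of_indepFun {A B : Ω → ℝ} (hA : Measurable A) (hB : Measurable B)
    (hAB : IndepFun A B μ) (i j : ℕ) :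
    ∫ ω, A ω ^ i * B ω ^ j ∂μ = (∫ ω, A ω ^ i ∂μ) * ∫ ω, B ω ^ j ∂μ :=
  IndepFun.integral_fun_mul_eq_mul_integral
    (hAB.comp (φ := fun x => x ^ i) (ψ := fun x => x ^ j) (by fun_prop) (by fun_prop))
    (by fun_prop) (by fun_prop)

lemma integral_add_pow_of_indepFun [IsFiniteMeasure μ] {A B : Ω → ℝ} (hA : Measurable A)
    (hB : Measurable B) {C D : ℝ} (hC : ∀ ω, |A ω| ≤ C) (hD : ∀ ω, |B ω| ≤ D)
    (hAB : IndepFun A B μ) (n : ℕ) :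
    ∫ ω, (A ω + B ω) ^ n ∂μ = ∑ i ∈ Finset.range (n + 1),
      (n.choose i : ℝ) * ((∫ ω, A ω ^ i ∂μ) * ∫ ω, B ω ^ (n - i) ∂μ) := by
  simp_rw [add_pow]
  rw [integral_finsetSum _ fun i _ => (integrable_pow_mul_pow hA hB hC hD _ _).mul_const _]
  refine Finset.sum_congr rfl fun i _ => ?_
  rw [integral_mul_const, integral_pow_mul_pow_of_indepFun hA hB hAB, mul_comm]

section WeightedSigns

variable [IsProbabilityMeasure μ] {ι : Type*} {X : ι → Ω → ℝ} {q Q : ι → ℝ}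
  (hX : ∀ i, Measurable (X i)) (hind : iIndepFun X μ) (hsq : ∀ i ω, X i ω ^ 2 = q i ^ 2)
include hX hsq

lemma integral_sum_weightedSigns (hQ : ∀ i, ∫ ω, X i ω ∂μ = Q i) (s : Finset ι) :
    ∫ ω, ∑ i ∈ s, X i ω ∂μ = ∑ i ∈ s, Q i := by
  rw [integral_finsetSum _ fun i _ => integrable_of_abs_le (hX i)
    fun ω => ((sq_eq_sq_iff_abs_eq_abs _ _).1 (hsq i ω)).le]
  exact Finset.sum_congr rfl fun i _ => hQ i

variable {a : ι} {s : Finset ι} (ha : a ∉ s)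
include hind ha

lemma integral_sum_cons_pow (n : ℕ) :
    ∫ ω, (∑ i ∈ s.cons a ha, X i ω) ^ n ∂μ = ∑ k ∈ Finset.range (n + 1), (n.choose k : ℝ) *
      ((∫ ω, (∑ i ∈ s, X i ω) ^ k ∂μ) * ∫ ω, X a ω ^ (n - k) ∂μ) := by
  have habs : ∀ i ω, |X i ω| ≤ |q i| := fun i ω => ((sq_eq_sq_iff_abs_eq_abs _ _).1 (hsq i ω)).le
  have hindep : IndepFun (fun ω => ∑ i ∈ s, X i ω) (X a) μ := by
    simpa only [← Finset.sum_apply] using hind.indepFun_finsetSum_of_notMem hX ha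
  simp_rw [Finset.sum_cons, add_comm (X a _)]
  exact integral_add_pow_of_indepFun (Finset.measurable_fun_sum s fun i _ => hX i) (hX a)
    (fun ω => (Finset.abs_sum_le_sum_abs _ _).trans (Finset.sum_le_sum fun i _ => habs i ω))
    (habs a) hindep n

variable (hQ : ∀ i, ∫ ω, X i ω ∂μ = Q i)
include hQ

lemma integral_sum_cons_sq :
    ∫ ω, (∑ i ∈ s.cons a ha, X i ω) ^ 2 ∂μ =
      ∫ ω, (∑ i ∈ s, X i ω) ^ 2 ∂μ + 2 * Q a * ∫ ω, ∑ i ∈ s, X i ω ∂μ + q a ^ 2 := by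
  rw [integral_sum_cons_pow hX hind hsq ha]
  simp only [Nat.reduceAdd, Finset.sum_range_succ, Finset.range_one, Finset.sum_singleton,
    Nat.choose_zero_right, Nat.cast_one, pow_zero, integral_const, probReal_univ, smul_eq_mul,
    mul_one, tsub_zero, hsq, one_mul, Nat.choose_succ_self_right, Nat.cast_ofNat, pow_one,
    Nat.add_one_sub_one, hQ, Nat.choose_self, tsub_self]
  ring

lemma integral_sum_cons_pow_three :
    ∫ ω, (∑ i ∈ s.cons a ha, X i ω) ^ 3 ∂μ =
      ∫ ω, (∑ i ∈ s, X i ω) ^ 3 ∂μ + 3 * Q a * ∫ ω, (∑ i ∈ s, X i ω) ^ 2 ∂μ +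
        3 * q a ^ 2 * ∫ ω, ∑ i ∈ s, X i ω ∂μ + q a ^ 2 * Q a := by
  have hcube : ∀ ω, X a ω ^ 3 = q a ^ 2 * X a ω := fun ω => by rw [pow_succ, hsq]
  rw [integral_sum_cons_pow hX hind hsq ha]
  simp only [Nat.reduceAdd, Finset.sum_range_succ, Finset.range_one, Finset.sum_singleton,
    Nat.choose, Nat.cast_one, pow_zero, integral_const, probReal_univ, smul_eq_mul, mul_one,
    tsub_zero, hcube, integral_const_mul, hQ, one_mul, add_zero, Nat.cast_ofNat, pow_one,
    Nat.add_one_sub_one, hsq, Nat.reduceSub, tsub_self]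
  ring

lemma integral_sum_cons_pow_four :
    ∫ ω, (∑ i ∈ s.cons a ha, X i ω) ^ 4 ∂μ =
      ∫ ω, (∑ i ∈ s, X i ω) ^ 4 ∂μ + 4 * Q a * ∫ ω, (∑ i ∈ s, X i ω) ^ 3 ∂μ +
        6 * q a ^ 2 * ∫ ω, (∑ i ∈ s, X i ω) ^ 2 ∂μ +
        4 * q a ^ 2 * Q a * ∫ ω, ∑ i ∈ s, X i ω ∂μ + q a ^ 4 := by
  have hcube : ∀ ω, X a ω ^ 3 = q a ^ 2 * X a ω := fun ω => by rw [pow_succ, hsq]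
  have hfour : ∀ ω, X a ω ^ 4 = q a ^ 4 := fun ω => by
    rw [show 4 = 2 * 2 from rfl, pow_mul, hsq, pow_mul]
  rw [integral_sum_cons_pow hX hind hsq ha]
  simp only [Nat.reduceAdd, Finset.sum_range_succ, Finset.range_one, Finset.sum_singleton,
    Nat.choose, Nat.cast_one, pow_zero, integral_const, probReal_univ, smul_eq_mul, mul_one,
    tsub_zero, hfour, one_mul, add_zero, Nat.cast_ofNat, pow_one, Nat.add_one_sub_one, hcube,
    integral_const_mul, hQ, Nat.reduceSub, hsq, tsub_self]
  ring

end WeightedSigns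

section CenteredSigns

variable [IsProbabilityMeasure μ] {ι : Type*} {X : ι → Ω → ℝ} {q : ι → ℝ}
  (hX : ∀ i, Measurable (X i)) (hind : iIndepFun X μ) (hsq : ∀ i ω, X i ω ^ 2 = q i ^ 2)
  (hmean : ∀ i, ∫ ω, X i ω ∂μ = 0) (s : Finset ι)
include hX hind hsq hmean

lemma integral_sum_centeredSigns_sq :
    ∫ ω, (∑ i ∈ s, X i ω) ^ 2 ∂μ = ∑ i ∈ s, q i ^ 2 := by
  induction s using Finset.cons_induction with
  | empty => simp
  | cons a s ha ih =>
    rw [integral_sum_cons_sq hX hind hsq ha hmean, ih, Finset.sum_cons]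
    ring

lemma integral_sum_centeredSigns_pow_four_le :
    ∫ ω, (∑ i ∈ s, X i ω) ^ 4 ∂μ ≤ 3 * (∑ i ∈ s, q i ^ 2) ^ 2 := by
  induction s using Finset.cons_induction with
  | empty => simp
  | cons a s ha ih =>
    rw [integral_sum_cons_pow_four hX hind hsq ha hmean,
      integral_sum_centeredSigns_sq hX hind hsq hmean, Finset.sum_cons]
    nlinarith [sq_nonneg (q a ^ 2)]

end CenteredSigns

section Signs

variable [IsProbabilityMeasure μ] {ι : Type*} {X : ι → Ω → ℝ} {Q : ℝ}
  (hX : ∀ i, Measurable (X i)) (hind : iIndepFun X μ) (hsq : ∀ i ω, X i ω ^ 2 = 1)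
  (hQ : ∀ i, ∫ ω, X i ω ∂μ = Q) (s : Finset ι)
include hX hsq hQ

lemma integral_sum_signs : ∫ ω, ∑ i ∈ s, X i ω ∂μ = s.card * Q := by
  rw [integral_sum_weightedSigns (q := 1) hX (by simpa using hsq) hQ, Finset.sum_const,
    nsmul_eq_mul]

include hind

lemma integral_sum_signs_sq :
    ∫ ω, (∑ i ∈ s, X i ω) ^ 2 ∂μ = s.card + s.card * (s.card - 1) * Q ^ 2 := by
  induction s using Finset.cons_induction with
  | empty => simp
  | cons a s ha ih =>
    rw [integral_sum_cons_sq (q := 1) hX hind (by simpa using hsq) ha hQ, ih,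
      integral_sum_signs hX hsq hQ, Finset.card_cons, Pi.one_apply]
    push_cast
    ring

lemma integral_sum_signs_pow_three :
    ∫ ω, (∑ i ∈ s, X i ω) ^ 3 ∂μ =
      s.card * (s.card - 1) * (s.card - 2) * Q ^ 3 + 3 * (s.card * (s.card - 1)) * Q
        + s.card * Q := by
  induction s using Finset.cons_induction with
  | empty => simp
  | cons a s ha ih =>
    rw [integral_sum_cons_pow_three (q := 1) hX hind (by simpa using hsq) ha hQ, ih,
      integral_sum_signs_sq hX hind hsq hQ, integral_sum_signs hX hsq hQ, Finset.card_cons,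
      Pi.one_apply]
    push_cast
    ring

lemma integral_sum_signs_pow_four :
    ∫ ω, (∑ i ∈ s, X i ω) ^ 4 ∂μ =
      s.card * (s.card - 1) * (s.card - 2) * (s.card - 3) * Q ^ 4
        + 6 * (s.card * (s.card - 1) * (s.card - 2)) * Q ^ 2
        + (3 + 4 * Q ^ 2) * (s.card * (s.card - 1)) + s.card := by
  induction s using Finset.cons_induction with
  | empty => simp
  | cons a s ha ih =>
    rw [integral_sum_cons_pow_four (q := 1) hX hind (by simpa using hsq) ha hQ, ih,
      integral_sum_signs_pow_three hX hind hsq hQ, integral_sum_signs_sq hX hind hsq hQ,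
      integral_sum_signs hX hsq hQ, Finset.card_cons, Pi.one_apply]
    push_cast
    ring

end Signs

end Moments

section Poisson

open scoped Nat

lemma hasSum_descFactorial_poisson (m : ℝ≥0) (k : ℕ) :
    HasSum (fun n : ℕ => (Real.exp (-m) * m ^ n / n !) * (n.descFactorial k : ℝ))
      ((m : ℝ) ^ k) := by
  have hlow : ∑ i ∈ Finset.range k,
      (Real.exp (-m) * m ^ i / i !) * (i.descFactorial k : ℝ) = 0 :=
    Finset.sum_eq_zero fun i hi => by
      rw [Nat.descFactorial_of_lt (Finset.mem_range.1 hi), Nat.cast_zero, mul_zero]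
  rw [← hasSum_nat_add_iff' k, hlow, sub_zero]
  have hshift := (hasSum_one_poissonMeasure m).mul_left ((m : ℝ) ^ k)
  rw [mul_one] at hshift
  refine hshift.congr_fun fun n => ?_
  have hfact : ((n + k)! : ℝ) = n ! * ((n + k).descFactorial k : ℝ) := by
    rw [← Nat.factorial_mul_descFactorial (Nat.le_add_left k n), Nat.add_sub_cancel, Nat.cast_mul]
  have hdesc : ((n + k).descFactorial k : ℝ) ≠ 0 := by
    simp [Nat.descFactorial_eq_zero_iff_lt]
  rw [hfact, pow_add]
  field_simp

lemma integrable_descFactorial_poisson (m : ℝ≥0) (k : ℕ) :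
    Integrable (fun n : ℕ => (n.descFactorial k : ℝ)) (poissonMeasure m) := by
  rw [integrable_poissonMeasure_iff]
  simpa using (hasSum_descFactorial_poisson m k).summable

lemma integral_descFactorial_poisson (m : ℝ≥0) (k : ℕ) :
    ∫ n : ℕ, (n.descFactorial k : ℝ) ∂poissonMeasure m = (m : ℝ) ^ k := by
  rw [integral_poissonMeasure]
  exact (hasSum_descFactorial_poisson m k).tsum_eq

lemma integral_sum_descFactorial_poisson (m : ℝ≥0) {d : ℕ} (c : Fin d → ℝ) :
    ∫ n : ℕ, ∑ i, c i * n.descFactorial i ∂poissonMeasure m = ∑ i, c i * (m : ℝ) ^ (i : ℕ) := by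
  rw [integral_finsetSum Finset.univ
    fun (i : Fin d) _ => (integrable_descFactorial_poisson m i).const_mul (c i)]
  simp_rw [integral_const_mul, integral_descFactorial_poisson]

lemma cast_descFactorial_three (n : ℕ) :
    (n.descFactorial 3 : ℝ) = n * (n - 1) * (n - 2) := by
  rw [← descPochhammer_eval_eq_descFactorial ℝ, descPochhammer_eval_eq_prod_range]
  simp [Finset.prod_range_succ]

lemma cast_descFactorial_four (n : ℕ) :
    (n.descFactorial 4 : ℝ) = n * (n - 1) * (n - 2) * (n - 3) := by
  rw [← descPochhammer_eval_eq_descFactorial ℝ, descPochhammer_eval_eq_prod_range]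
  simp [Finset.prod_range_succ]

lemma integrable_pow_four_poisson (m : ℝ≥0) :
    Integrable (fun n : ℕ => (n : ℝ) ^ 4) (poissonMeasure m) := by
  have h : Integrable (fun n : ℕ => ∑ i : Fin 5, ![0, 1, 7, 6, 1] i * (n.descFactorial i : ℝ))
      (poissonMeasure m) :=
    integrable_finsetSum _ fun i _ => (integrable_descFactorial_poisson m i).const_mul _
  refine h.congr (ae_of_all _ fun n => ?_)
  simp only [Fin.sum_univ_five, Fin.isValue, Fin.coe_ofNat_eq_mod, Nat.reduceMod,
    Matrix.cons_val, Nat.descFactorial_one, Nat.cast_descFactorial_two, cast_descFactorial_three,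
    cast_descFactorial_four]
  ring

end Poisson

section PoissonSumsOfSigns

lemma measurable_poissonSum {Ω : Type*} [MeasurableSpace Ω] {X : ℕ → Ω → ℝ}
    (hX : ∀ i, Measurable (X i)) :
    Measurable fun z : ℕ × Ω => ∑ i ∈ Finset.range z.1, X i z.2 :=
  measurable_from_prod_countable_right fun n =>
    Finset.measurable_fun_sum (Finset.range n) fun i _ => hX i

variable {Ω : Type*} [MeasurableSpace Ω] {μ : Measure Ω} [IsProbabilityMeasure μ] {X : ℕ → Ω → ℝ}
  (hX : ∀ i, Measurable (X i)) (hsq : ∀ i ω, X i ω ^ 2 = 1) (m : ℝ≥0)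
include hX hsq

lemma integrable_poissonSum_signs_pow_four :
    Integrable (fun z : ℕ × Ω => (∑ i ∈ Finset.range z.1, X i z.2) ^ 4)
      ((poissonMeasure m).prod μ) := by
  have habs : ∀ i ω, |X i ω| ≤ 1 := fun i ω => (sq_le_one_iff_abs_le_one _).1 (hsq i ω).le
  refine ((integrable_pow_four_poisson m).comp_fst μ).mono' ?_ (ae_of_all _ fun z => ?_)
  · exact ((measurable_poissonSum hX).pow_const 4).aestronglyMeasurable
  · rw [norm_pow, Real.norm_eq_abs]
    gcongr
    refine (Finset.abs_sum_le_sum_abs _ _).trans ?_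
    simpa using Finset.sum_le_sum fun i (_ : i ∈ Finset.range z.1) => habs i z.2

lemma memLp_poissonSum_signs_sq :
    MemLp (fun z : ℕ × Ω => (∑ i ∈ Finset.range z.1, X i z.2) ^ 2) 2
      ((poissonMeasure m).prod μ) := by
  rw [memLp_two_iff_integrable_sq]
  · simpa only [← pow_mul] using integrable_poissonSum_signs_pow_four hX hsq m
  · exact ((measurable_poissonSum hX).pow_const 2).aestronglyMeasurable

variable (hind : iIndepFun X μ) {Q : ℝ} (hQ : ∀ i, ∫ ω, X i ω ∂μ = Q)
include hind hQ

lemma integral_poissonSum_signs_sq :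
    ∫ z, (∑ i ∈ Finset.range z.1, X i z.2) ^ 2 ∂(poissonMeasure m).prod μ =
      m + m ^ 2 * Q ^ 2 := by
  rw [integral_prod _ ((memLp_poissonSum_signs_sq hX hsq m).integrable one_le_two)]
  calc _ = ∫ n : ℕ, ∑ i : Fin 3, ![0, 1, Q ^ 2] i * (n.descFactorial i : ℝ) ∂poissonMeasure m := by
        refine integral_congr_ae (ae_of_all _ fun n => ?_)
        simp only [integral_sum_signs_sq hX hind hsq hQ, Finset.card_range, Fin.sum_univ_three,
          Fin.isValue, Fin.coe_ofNat_eq_mod, Nat.reduceMod, Matrix.cons_val,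
          Nat.descFactorial_one, Nat.cast_descFactorial_two]
        ring
    _ = m + m ^ 2 * Q ^ 2 := by
        rw [integral_sum_descFactorial_poisson]
        simp only [Fin.sum_univ_three, Fin.isValue, Fin.coe_ofNat_eq_mod, Nat.reduceMod,
          Matrix.cons_val]
        ring

lemma integral_poissonSum_signs_pow_four :
    ∫ z, (∑ i ∈ Finset.range z.1, X i z.2) ^ 4 ∂(poissonMeasure m).prod μ =
      m ^ 4 * Q ^ 4 + 6 * m ^ 3 * Q ^ 2 + (3 + 4 * Q ^ 2) * m ^ 2 + m := by
  rw [integral_prod _ (integrable_poissonSum_signs_pow_four hX hsq m)]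
  -- The coefficients expand the fourth moment of a sum of `n` signs in falling factorials of `n`,
  -- whose Poisson means are the powers of `m`.
  calc _ = ∫ n : ℕ, ∑ i : Fin 5, ![0, 1, 3 + 4 * Q ^ 2, 6 * Q ^ 2, Q ^ 4] i *
        (n.descFactorial i : ℝ) ∂poissonMeasure m := by
        refine integral_congr_ae (ae_of_all _ fun n => ?_)
        simp only [integral_sum_signs_pow_four hX hind hsq hQ, Finset.card_range,
          Fin.sum_univ_five, Fin.isValue, Fin.coe_ofNat_eq_mod, Nat.reduceMod, Matrix.cons_val,
          Nat.descFactorial_one, Nat.cast_descFactorial_two, cast_descFactorial_three,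
          cast_descFactorial_four]
        ring
    _ = _ := by
        rw [integral_sum_descFactorial_poisson]
        simp only [Fin.sum_univ_five, Fin.isValue, Fin.coe_ofNat_eq_mod, Nat.reduceMod,
          Matrix.cons_val]
        ring

end PoissonSumsOfSigns

section PoissonTail

open scoped Nat

lemma poissonMeasure_zero : poissonMeasure 0 = Measure.dirac 0 := by
  refine Measure.ext_of_singleton fun n => ?_
  rcases n with _ | n <;> simp [poissonMeasure_singleton]

lemma hasLaw_sum_poissonMeasure {Ω ι : Type*} {mΩ : MeasurableSpace Ω} {P : Measure Ω}
    [IsProbabilityMeasure P] {X : ι → Ω → ℕ} {r : ι → ℝ≥0} (hX : ∀ i, Measurable (X i))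
    (hlaw : ∀ i, HasLaw (X i) (poissonMeasure (r i)) P) (hind : iIndepFun X P) (s : Finset ι) :
    HasLaw (fun ω => ∑ i ∈ s, X i ω) (poissonMeasure (∑ i ∈ s, r i)) P := by
  induction s using Finset.cons_induction with
  | empty =>
    simp only [Finset.sum_empty, poissonMeasure_zero]
    exact ⟨by fun_prop, by simp⟩
  | cons a s ha ih =>
    have hadd : IndepFun (X a) (fun ω => ∑ i ∈ s, X i ω) P := by
      simpa only [← Finset.sum_apply] using (hind.indepFun_finsetSum_of_notMem hX ha).symm
    simp only [Finset.sum_cons]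
    exact hadd.hasLaw_add_poissonMeasure (hlaw a) ih

variable (m : ℝ≥0) (t : ℝ)

lemma hasSum_exp_mul_poisson :
    HasSum (fun n : ℕ => (Real.exp (-m) * m ^ n / n !) * Real.exp (t * n))
      (Real.exp (m * (Real.exp t - 1))) := by
  have h := (hasSum_one_poissonMeasure (m * (Real.exp t).toNNReal)).mul_left
    (Real.exp (m * (Real.exp t - 1)))
  rw [mul_one] at h
  refine h.congr_fun fun n => ?_
  have hsplit : Real.exp (-m) = Real.exp (m * (Real.exp t - 1)) * Real.exp (-(m * Real.exp t)) := by
    rw [← Real.exp_add]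
    ring_nf
  rw [hsplit, NNReal.coe_mul, Real.coe_toNNReal _ (Real.exp_pos t).le, mul_pow, mul_comm t,
    Real.exp_nat_mul]
  ring

lemma integrable_exp_mul_poisson :
    Integrable (fun n : ℕ => Real.exp (t * n)) (poissonMeasure m) := by
  rw [integrable_poissonMeasure_iff]
  simpa using (hasSum_exp_mul_poisson m t).summable

lemma mgf_poissonMeasure :
    mgf (fun n : ℕ => (n : ℝ)) (poissonMeasure m) t = Real.exp (m * (Real.exp t - 1)) := by
  rw [mgf, integral_poissonMeasure]
  exact (hasSum_exp_mul_poisson m t).tsum_eq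

lemma poissonMeasure_ge_four_mul_le :
    (poissonMeasure m).real {n : ℕ | 4 * (m : ℝ) ≤ n} ≤ Real.exp (-m) := by
  refine (measure_ge_le_exp_mul_mgf (X := fun n : ℕ => (n : ℝ)) (4 * (m : ℝ))
    (Real.log_nonneg one_le_two) (integrable_exp_mul_poisson m _)).trans ?_
  rw [mgf_poissonMeasure, Real.exp_log two_pos, ← Real.exp_add, Real.exp_le_exp]
  nlinarith [Real.log_two_gt_d9, m.coe_nonneg]

end PoissonTail

section RandomSigns

lemma sign_sq (u : ℤˣ) : ((u : ℤ) : ℝ) ^ 2 = 1 := by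
  rcases Int.units_eq_one_or u with rfl | rfl <;> simp

lemma abs_sign (u : ℤˣ) : |((u : ℤ) : ℝ)| = 1 := by
  rcases Int.units_eq_one_or u with rfl | rfl <;> simp

lemma integral_uniformOn_sign : ∫ u : ℤˣ, ((u : ℤ) : ℝ) ∂uniformOn Set.univ = 0 := by
  have hmass : ∀ u, (uniformOn (Set.univ : Set ℤˣ)).real {u} = 1 / 2 := fun u => by
    simp [Measure.real, uniformOn_univ]
  rw [integral_fintype .of_finite, show (Finset.univ : Finset ℤˣ) = {1, -1} from rfl,
    Finset.sum_pair (by decide), hmass, hmass]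
  simp

/-- The law of uniformly random independent signs indexed by `Z`, a random hash function. -/
noncomputable def signLaw (Z : Type*) : Measure (Z → ℤˣ) :=
  Measure.infinitePi fun _ => uniformOn (Set.univ : Set ℤˣ)

instance (Z : Type*) : IsProbabilityMeasure (signLaw Z) := by unfold signLaw; infer_instance

variable {Z : Type*}

lemma measurable_sign_apply (z : Z) : Measurable fun c : Z → ℤˣ => ((c z : ℤ) : ℝ) :=
  (Measurable.of_discrete (f := fun u : ℤˣ => ((u : ℤ) : ℝ))).comp (measurable_pi_apply z)

lemma integral_sign_apply (z : Z) : ∫ c, ((c z : ℤ) : ℝ) ∂signLaw Z = 0 :=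
  (integral_eval_infinitePi (fun _ : Z => uniformOn (Set.univ : Set ℤˣ)) z
    (f := fun u => ((u : ℤ) : ℝ)) .of_discrete).trans integral_uniformOn_sign

lemma iIndepFun_signLaw (f : Z → ℤˣ → ℝ) :
    iIndepFun (fun z (c : Z → ℤˣ) => f z (c z)) (signLaw Z) :=
  iIndepFun_infinitePi fun _ => .of_discrete

lemma hasSubgaussianMGF_sign_apply (z : Z) :
    HasSubgaussianMGF (fun c : Z → ℤˣ => ((c z : ℤ) : ℝ)) 1 (signLaw Z) := by
  have h := hasSubgaussianMGF_of_mem_Icc_of_integral_eq_zero (a := -1) (b := 1)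
    (measurable_sign_apply z).aemeasurable
    (ae_of_all _ fun c => abs_le.1 (abs_sign (c z)).le) (integral_sign_apply z)
  convert h
  rw [Real.nnnorm_of_nonneg (by norm_num)]
  ext
  norm_num

lemma signLaw_abs_sum_ge_le (s : Finset Z) {c : ℝ} (hc : 0 ≤ c) :
    (signLaw Z).real {h | c ≤ |∑ z ∈ s, ((h z : ℤ) : ℝ)|} ≤
      2 * Real.exp (-c ^ 2 / (2 * s.card)) := by
  have hsub : HasSubgaussianMGF (fun h : Z → ℤˣ => ∑ z ∈ s, ((h z : ℤ) : ℝ)) s.card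
      (signLaw Z) := by
    simpa using HasSubgaussianMGF.sum_of_iIndepFun (s := s) (c := fun _ => 1)
      (iIndepFun_signLaw fun _ u => ((u : ℤ) : ℝ)) fun z _ => hasSubgaussianMGF_sign_apply z
  have hsplit : {h : Z → ℤˣ | c ≤ |∑ z ∈ s, ((h z : ℤ) : ℝ)|} =
      {h | c ≤ ∑ z ∈ s, ((h z : ℤ) : ℝ)} ∪ {h | c ≤ (-fun h => ∑ z ∈ s, ((h z : ℤ) : ℝ)) h} :=
    Set.ext fun h => by simp only [Set.mem_union, Set.mem_ofPred_eq, Pi.neg_apply, le_abs]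
  rw [hsplit, two_mul]
  exact (measureReal_union_le _ _).trans
    (add_le_add (hsub.measure_ge_le hc) (hsub.neg.measure_ge_le hc))

end RandomSigns

section MeanSign

variable {Z : Type*} [Fintype Z] [MeasurableSpace Z] (q : Measure Z)

/-- The mean hash value of a user whose salted sample has law `q`, for the hash function `c`. -/
noncomputable def meanSign (c : Z → ℤˣ) : ℝ := ∑ z, q.real {z} * ((c z : ℤ) : ℝ)

lemma measurable_meanSign : Measurable (meanSign q) :=
  Finset.measurable_fun_sum _ fun z _ => (measurable_sign_apply z).const_mul _

lemma integral_meanSign_sq : ∫ c, meanSign q c ^ 2 ∂signLaw Z = ∑ z, q.real {z} ^ 2 :=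
  integral_sum_centeredSigns_sq (fun z => (measurable_sign_apply z).const_mul _)
    (iIndepFun_signLaw fun z u => q.real {z} * ((u : ℤ) : ℝ))
    (fun z c => by rw [mul_pow, sign_sq, mul_one])
    (fun z => by rw [integral_const_mul, integral_sign_apply, mul_zero]) Finset.univ

lemma integral_meanSign_pow_four_le :
    ∫ c, meanSign q c ^ 4 ∂signLaw Z ≤ 3 * (∑ z, q.real {z} ^ 2) ^ 2 :=
  integral_sum_centeredSigns_pow_four_le (fun z => (measurable_sign_apply z).const_mul _)
    (iIndepFun_signLaw fun z u => q.real {z} * ((u : ℤ) : ℝ))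
    (fun z c => by rw [mul_pow, sign_sq, mul_one])
    (fun z => by rw [integral_const_mul, integral_sign_apply, mul_zero]) Finset.univ

variable [MeasurableSingletonClass Z] [IsProbabilityMeasure q]

lemma integral_sign_eq_meanSign (c : Z → ℤˣ) : ∫ z, ((c z : ℤ) : ℝ) ∂q = meanSign q c := by
  rw [integral_fintype .of_finite]
  rfl

lemma abs_meanSign_le_one (c : Z → ℤˣ) : |meanSign q c| ≤ 1 := by
  refine (Finset.abs_sum_le_sum_abs _ _).trans_eq ?_
  simp only [abs_mul, abs_sign, mul_one, abs_of_nonneg measureReal_nonneg]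
  rw [sum_measureReal_singleton, Finset.coe_univ, probReal_univ]

lemma integrable_meanSign_pow (k : ℕ) : Integrable (fun c => meanSign q c ^ k) (signLaw Z) :=
  integrable_of_abs_le ((measurable_meanSign q).pow_const k) (C := 1) fun c => by
    rw [abs_pow]
    exact pow_le_one₀ (abs_nonneg _) (abs_meanSign_le_one q c)

end MeanSign

section GroupModel

variable {Z : Type*}

/-- The sum of the hash values of a group with hash function `z.1` and `z.2.1` users, the `i`-th of
whom has the salted sample `z.2.2 i`. -/
def signSum (z : (Z → ℤˣ) × ℕ × (ℕ → Z)) : ℤ := ∑ i ∈ Finset.range z.2.1, (z.1 (z.2.2 i) : ℤ)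

lemma abs_signSum_le (z : (Z → ℤˣ) × ℕ × (ℕ → Z)) : |(signSum z : ℝ)| ≤ z.2.1 := by
  unfold signSum
  push_cast
  refine (Finset.abs_sum_le_sum_abs _ _).trans_eq ?_
  simp only [abs_sign, Finset.sum_const, Finset.card_range, nsmul_eq_mul, mul_one]

variable [Countable Z] [MeasurableSpace Z] [MeasurableSingletonClass Z]

lemma measurable_signSum : Measurable (signSum (Z := Z)) := by
  have hterm : ∀ i, Measurable fun z : (Z → ℤˣ) × ℕ × (ℕ → Z) => ((z.1 (z.2.2 i) : ℤˣ) : ℤ) :=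
    fun i => (Measurable.of_discrete (f := fun u : ℤˣ => (u : ℤ))).comp
      (measurable_eval_at (by fun_prop) (by fun_prop))
  exact measurable_eval_at (f := fun (z : (Z → ℤˣ) × ℕ × (ℕ → Z)) n =>
    ∑ i ∈ Finset.range n, (z.1 (z.2.2 i) : ℤ)) (by fun_prop) (by fun_prop)

lemma measurable_signSum_pow (k : ℕ) :
    Measurable fun z : (Z → ℤˣ) × ℕ × (ℕ → Z) => (signSum z : ℝ) ^ k :=
  (measurable_from_top.comp measurable_signSum).pow_const k

variable (m : ℝ≥0) (q : Measure Z)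

/-- The law of the hash function, the number of users and their salted samples in a group. -/
noncomputable def groupLaw : Measure ((Z → ℤˣ) × ℕ × (ℕ → Z)) :=
  (signLaw Z).prod ((poissonMeasure m).prod (Measure.infinitePi fun _ : ℕ => q))

variable [IsProbabilityMeasure q]

instance : IsProbabilityMeasure (groupLaw m q) := by unfold groupLaw; infer_instance

lemma integrable_signSum_pow_four :
    Integrable (fun z => (signSum z : ℝ) ^ 4) (groupLaw m q) := by
  have hsize : Integrable (fun z : (Z → ℤˣ) × ℕ × (ℕ → Z) => (z.2.1 : ℝ) ^ 4) (groupLaw m q) :=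
    ((integrable_pow_four_poisson m).comp_fst _).comp_snd (signLaw Z)
  refine hsize.mono' (measurable_signSum_pow 4).aestronglyMeasurable (ae_of_all _ fun z => ?_)
  rw [norm_pow]
  gcongr
  exact abs_signSum_le z

lemma memLp_signSum_sq : MemLp (fun z => (signSum z : ℝ) ^ 2) 2 (groupLaw m q) := by
  rw [memLp_two_iff_integrable_sq (measurable_signSum_pow 2).aestronglyMeasurable]
  simpa only [← pow_mul] using integrable_signSum_pow_four m q

end GroupModel

section GroupMoments

variable {Z : Type*} [Fintype Z] [MeasurableSpace Z] [MeasurableSingletonClass Z]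
  (m : ℝ≥0) (q : Measure Z) [IsProbabilityMeasure q]

lemma integral_signSum_sq :
    ∫ z, (signSum z : ℝ) ^ 2 ∂groupLaw m q = m + m ^ 2 * ∑ z, q.real {z} ^ 2 := by
  have hcond : ∀ c : Z → ℤˣ, ∫ y, (signSum (c, y) : ℝ) ^ 2
      ∂(poissonMeasure m).prod (Measure.infinitePi fun _ : ℕ => q) =
        m + m ^ 2 * meanSign q c ^ 2 := fun c => by
    have hc : Measurable fun z => ((c z : ℤ) : ℝ) := .of_discrete
    simpa only [signSum, Int.cast_sum] using integral_poissonSum_signs_sq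
      (X := fun i (y : ℕ → Z) => ((c (y i) : ℤ) : ℝ)) (fun i => hc.comp (measurable_pi_apply i))
      (fun i y => sign_sq _) m (iIndepFun_infinitePi (P := fun _ : ℕ => q) fun _ => hc)
      (fun i => (integral_eval_infinitePi (fun _ : ℕ => q) i hc).trans
        (integral_sign_eq_meanSign q c))
  rw [groupLaw, integral_prod _ ((memLp_signSum_sq m q).integrable one_le_two)]
  simp_rw [hcond]
  rw [integral_add (integrable_const _) ((integrable_meanSign_pow q 2).const_mul _),
    integral_const_mul, integral_meanSign_sq]
  simp

lemma integral_signSum_pow_four_le :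
    ∫ z, (signSum z : ℝ) ^ 4 ∂groupLaw m q ≤
      3 * m ^ 4 * (∑ z, q.real {z} ^ 2) ^ 2 + (6 * m ^ 3 + 4 * m ^ 2) * ∑ z, q.real {z} ^ 2 +
        (3 * m ^ 2 + m) := by
  have hcond : ∀ c : Z → ℤˣ, ∫ y, (signSum (c, y) : ℝ) ^ 4
      ∂(poissonMeasure m).prod (Measure.infinitePi fun _ : ℕ => q) =
        m ^ 4 * meanSign q c ^ 4 + (6 * m ^ 3 + 4 * m ^ 2) * meanSign q c ^ 2 +
          (3 * m ^ 2 + m) := fun c => by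
    have hc : Measurable fun z => ((c z : ℤ) : ℝ) := .of_discrete
    simp only [signSum, Int.cast_sum]
    rw [integral_poissonSum_signs_pow_four
      (X := fun i (y : ℕ → Z) => ((c (y i) : ℤ) : ℝ)) (fun i => hc.comp (measurable_pi_apply i))
      (fun i y => sign_sq _) m (iIndepFun_infinitePi (P := fun _ : ℕ => q) fun _ => hc)
      (fun i => (integral_eval_infinitePi (fun _ : ℕ => q) i hc).trans
        (integral_sign_eq_meanSign q c))]
    ring
  have h4 := (integrable_meanSign_pow q 4).const_mul ((m : ℝ) ^ 4)
  have h2 := (integrable_meanSign_pow q 2).const_mul (6 * (m : ℝ) ^ 3 + 4 * m ^ 2)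
  have h42 : Integrable (fun c => (m : ℝ) ^ 4 * meanSign q c ^ 4 +
      (6 * (m : ℝ) ^ 3 + 4 * m ^ 2) * meanSign q c ^ 2) (signLaw Z) := h4.add h2
  rw [groupLaw, integral_prod _ (integrable_signSum_pow_four m q)]
  simp_rw [hcond]
  rw [integral_add h42 (integrable_const _), integral_add h4 h2, integral_const_mul,
    integral_const_mul, integral_meanSign_sq, integral_const, probReal_univ, one_smul]
  linarith [mul_le_mul_of_nonneg_left (integral_meanSign_pow_four_le q) (pow_nonneg m.coe_nonneg 4)]

end GroupMoments

section SumLaw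

variable {Z : Type*} [Finite Z] [MeasurableSpace Z] [MeasurableSingletonClass Z]
  (m : ℝ≥0) (q : Measure Z)

/-- The law of the sum of the hash values of a group. -/
noncomputable def sumLaw : Measure ℤ := (groupLaw m q).map signSum

lemma integral_sumLaw (f : ℤ → ℝ) :
    ∫ v, f v ∂sumLaw m q = ∫ z, f (signSum z) ∂groupLaw m q :=
  integral_map measurable_signSum.aemeasurable measurable_from_top.aestronglyMeasurable

variable [IsProbabilityMeasure q]

instance : IsProbabilityMeasure (sumLaw m q) :=
  Measure.isProbabilityMeasure_map measurable_signSum.aemeasurable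

lemma sumLaw_apply (B : Set ℤ) :
    sumLaw m q B = ∫⁻ n, ((signLaw Z).prod (Measure.infinitePi fun _ : Fin n => q))
      {z | ∑ i, (z.1 (z.2 i) : ℤ) ∈ B} ∂poissonMeasure m := by
  have hB : MeasurableSet (signSum (Z := Z) ⁻¹' B) := measurable_signSum .of_discrete
  have hfin : ∀ n : ℕ, MeasurableSet {z : (Z → ℤˣ) × (Fin n → Z) | ∑ i, (z.1 (z.2 i) : ℤ) ∈ B} :=
    fun n => (.of_discrete : Measurable fun z : (Z → ℤˣ) × (Fin n → Z) =>
      ∑ i, (z.1 (z.2 i) : ℤ)) .of_discrete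
  calc sumLaw m q B
      = ∫⁻ c, ∫⁻ n, Measure.infinitePi (fun _ : ℕ => q) {y | signSum (c, n, y) ∈ B}
          ∂poissonMeasure m ∂signLaw Z := by
        rw [sumLaw, Measure.map_apply measurable_signSum .of_discrete, groupLaw,
          Measure.prod_apply hB]
        exact lintegral_congr fun c => Measure.prod_apply (measurable_prodMk_left hB)
    _ = ∫⁻ n, ∫⁻ c, Measure.infinitePi (fun _ : ℕ => q) {y | signSum (c, n, y) ∈ B}
          ∂signLaw Z ∂poissonMeasure m := by
        refine lintegral_lintegral_swap ?_
        exact (measurable_measure_prodMk_left ((by fun_prop : Measurable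
          fun w : ((Z → ℤˣ) × ℕ) × (ℕ → Z) => (w.1.1, w.1.2, w.2)) hB)).aemeasurable
    _ = _ := by
        refine lintegral_congr fun n => ?_
        rw [Measure.prod_apply (hfin n)]
        refine lintegral_congr fun c => ?_
        rw [← Measure.map_infinitePi_infinitePi_of_inj (P := fun _ : ℕ => q)
          (Fin.val_injective (n := n)), Measure.map_apply (by fun_prop)
          (measurable_prodMk_left (hfin n))]
        simp [signSum, Finset.sum_range]

lemma memLp_sumLaw_sq : MemLp (fun v : ℤ => (v : ℝ) ^ 2) 2 (sumLaw m q) := by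
  rw [sumLaw, memLp_map_measure_iff measurable_from_top.aestronglyMeasurable
    measurable_signSum.aemeasurable]
  exact memLp_signSum_sq m q

/-- The bias-corrected estimate from the sum `v` of the hash values of a group of expected size
`m`, with `r` salts. -/
noncomputable def sumEstimate (r : ℕ) (m : ℝ) (v : ℤ) : ℝ := r * ((v : ℝ) ^ 2 - m) / m ^ 2

lemma memLp_sumEstimate (r : ℕ) : MemLp (sumEstimate r m) 2 (sumLaw m q) := by
  have := ((memLp_sumLaw_sq m q).sub (memLp_const (m : ℝ))).const_mul (r / (m : ℝ) ^ 2)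
  refine this.ae_eq (ae_of_all _ fun v => ?_)
  simp only [Pi.sub_apply, sumEstimate]
  ring

end SumLaw

section SumLawMoments

variable {Z : Type*} [Fintype Z] [MeasurableSpace Z] [MeasurableSingletonClass Z]
  (m : ℝ≥0) (q : Measure Z) [IsProbabilityMeasure q]

lemma integral_sumLaw_sq :
    ∫ v : ℤ, (v : ℝ) ^ 2 ∂sumLaw m q = m + m ^ 2 * ∑ z, q.real {z} ^ 2 := by
  rw [integral_sumLaw, integral_signSum_sq]

lemma variance_sumLaw_sq_le :
    variance (fun v : ℤ => (v : ℝ) ^ 2) (sumLaw m q) ≤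
      2 * m ^ 4 * (∑ z, q.real {z} ^ 2) ^ 2 + 4 * (m ^ 3 + m ^ 2) * ∑ z, q.real {z} ^ 2 +
        (2 * m ^ 2 + m) := by
  have hfour : ∫ v : ℤ, ((fun v : ℤ => (v : ℝ) ^ 2) ^ 2) v ∂sumLaw m q =
      ∫ z, (signSum z : ℝ) ^ 4 ∂groupLaw m q := by
    rw [integral_sumLaw]
    simp only [Pi.pow_apply, ← pow_mul]
  rw [variance_eq_sub (memLp_sumLaw_sq m q), hfour, integral_sumLaw_sq]
  linarith [integral_signSum_pow_four_le m q]

lemma integral_sumEstimate (r : ℕ) (hm : 0 < m) :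
    ∫ v, sumEstimate r m v ∂sumLaw m q = r * ∑ z, q.real {z} ^ 2 := by
  have hsq := (memLp_sumLaw_sq m q).integrable one_le_two
  have hm0 : (m : ℝ) ≠ 0 := by exact_mod_cast hm.ne'
  simp only [sumEstimate]
  rw [integral_div, integral_const_mul, integral_sub hsq (integrable_const _), integral_sumLaw_sq]
  simp only [integral_const, probReal_univ, smul_eq_mul]
  field_simp
  ring

lemma variance_sumEstimate_le (r : ℕ) (hm : 0 < m) :
    variance (sumEstimate r m) (sumLaw m q) ≤
      2 * (r * ∑ z, q.real {z} ^ 2) ^ 2 + 4 * (r * ∑ z, q.real {z} ^ 2) * (r / m) +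
        2 * (r / m) ^ 2 + 4 * (r * ∑ z, q.real {z} ^ 2) * (r / m * (1 / m)) +
          (r / m) ^ 2 * (1 / m) := by
  have hm0 : (m : ℝ) ≠ 0 := by exact_mod_cast hm.ne'
  have hscale : sumEstimate r m = fun v : ℤ => (r / (m : ℝ) ^ 2) * ((v : ℝ) ^ 2 - m) :=
    funext fun v => by
      rw [sumEstimate]
      ring
  rw [hscale, variance_const_mul, variance_sub_const measurable_from_top.aestronglyMeasurable]
  refine (mul_le_mul_of_nonneg_left (variance_sumLaw_sq_le m q) (sq_nonneg _)).trans_eq ?_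
  field_simp
  ring

lemma variance_sumEstimate_le_five (r : ℕ) (hr : 1 ≤ r) (hm : 160 * (r : ℝ) ≤ 21 * m)
    (hS : r * ∑ z, q.real {z} ^ 2 ≤ 1) : variance (sumEstimate r m) (sumLaw m q) ≤ 5 := by
  have hr1 : (1 : ℝ) ≤ r := by exact_mod_cast hr
  have hm0 : (0 : ℝ) < m := by linarith
  have : 0 ≤ r * ∑ z, q.real {z} ^ 2 := by positivity
  have hratio : (r : ℝ) / m ≤ 21 / 160 := by
    rw [div_le_iff₀ hm0]
    linarith
  have hinv : 1 / (m : ℝ) ≤ 21 / 160 := by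
    rw [div_le_iff₀ hm0]
    linarith
  calc _ ≤ _ := variance_sumEstimate_le m q r (by exact_mod_cast hm0)
    _ ≤ 2 * 1 ^ 2 + 4 * 1 * (21 / 160) + 2 * (21 / 160) ^ 2 + 4 * 1 * ((21 / 160) * (21 / 160))
        + (21 / 160) ^ 2 * (21 / 160) := by gcongr
    _ ≤ 5 := by norm_num

end SumLawMoments

section Median

variable {L : List ℝ} {p : ℝ → Bool} {i : ℕ}

lemma getD_le_getD_of_pairwise (hL : L.Pairwise (· ≤ ·)) {j : ℕ} (hij : i ≤ j)
    (hj : j < L.length) : L.getD i 0 ≤ L.getD j 0 := by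
  rw [List.getD_eq_getElem _ _ (hij.trans_lt hj), List.getD_eq_getElem _ _ hj]
  rcases hij.eq_or_lt with rfl | hlt
  · exact le_rfl
  · exact List.pairwise_iff_getElem.1 hL _ _ _ _ hlt

lemma length_sub_le_countP (hL : L.Pairwise (· ≤ ·)) (hp : ∀ x, L.getD i 0 ≤ x → p x) :
    L.length - i ≤ L.countP p := by
  have hall : (L.drop i).countP p = (L.drop i).length := by
    refine List.countP_eq_length.2 fun x hx => hp x ?_
    obtain ⟨n, hn, rfl⟩ := List.mem_iff_getElem.1 hx
    rw [List.length_drop] at hn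
    have hin : i + n < L.length := by omega
    rw [List.getElem_drop, ← List.getD_eq_getElem _ 0 hin]
    exact getD_le_getD_of_pairwise hL (Nat.le_add_right i n) hin
  rw [← List.length_drop, ← hall]
  exact (List.drop_sublist i L).countP_le

lemma succ_le_countP (hL : L.Pairwise (· ≤ ·)) (hi : i < L.length)
    (hp : ∀ x, x ≤ L.getD i 0 → p x) : i + 1 ≤ L.countP p := by
  have hlen : (L.take (i + 1)).length = i + 1 := List.length_take_of_le hi
  have hall : (L.take (i + 1)).countP p = (L.take (i + 1)).length := by
    refine List.countP_eq_length.2 fun x hx => hp x ?_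
    obtain ⟨n, hn, rfl⟩ := List.mem_iff_getElem.1 hx
    have hni : n ≤ i := by omega
    rw [List.getElem_take, ← List.getD_eq_getElem _ 0 (hni.trans_lt hi)]
    exact getD_le_getD_of_pairwise hL hni hi
  rw [← hlen, ← hall]
  exact (List.take_sublist (i + 1) L).countP_le

lemma countP_insertionSort_map_range (a : ℕ) (f : ℕ → ℝ) (P : ℝ → Prop) [DecidablePred P] :
    (((List.range a).map f).insertionSort (· ≤ ·)).countP (fun x => decide (P x)) =
      ((Finset.range a).filter fun l => P (f l)).card := by
  rw [(List.perm_insertionSort _ _).countP_eq, List.countP_map, List.countP_eq_length_filter,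
    Finset.card_def, Finset.filter_val, Finset.range_val, Multiset.range, Multiset.filter_coe,
    Multiset.coe_card]
  rfl

lemma median_congr {a : ℕ} {f g : ℕ → ℝ} (h : ∀ l < a, f l = g l) : median a f = median a g := by
  have hmap : (List.range a).map f = (List.range a).map g :=
    List.map_congr_left fun l hl => h l (List.mem_range.1 hl)
  simp only [median, hmap]

lemma le_two_mul_card_of_lt_abs_median (a : ℕ) (f : ℕ → ℝ) (c w : ℝ)
    (h : w < |median a f - c|) :
    a ≤ 2 * ((Finset.range a).filter fun l => w < |f l - c|).card := by
  rcases a.eq_zero_or_pos with rfl | ha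
  · exact Nat.zero_le _
  rw [← countP_insertionSort_map_range a f fun x => w < |x - c|]
  simp only [median] at h
  set L := ((List.range a).map f).insertionSort (· ≤ ·) with hLdef
  have hlen : L.length = a := by
    rw [hLdef, List.length_insertionSort, List.length_map, List.length_range]
  have hL : L.Pairwise (· ≤ ·) := List.pairwise_insertionSort _ _
  have hmid : L.getD ((a - 1) / 2) 0 ≤ L.getD (a / 2) 0 :=
    getD_le_getD_of_pairwise hL (by omega) (by omega)
  rcases lt_abs.1 h with habove | hbelow
  · have := length_sub_le_countP (p := fun x => decide (w < |x - c|)) (i := a / 2) hL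
      fun x hx => decide_eq_true (lt_abs.2 (Or.inl (by linarith)))
    omega
  · have := succ_le_countP (p := fun x => decide (w < |x - c|)) (i := (a - 1) / 2) hL (by omega)
      fun x hx => decide_eq_true (lt_abs.2 (Or.inr (by linarith)))
    omega

lemma getD_insertionSort_le_iff {a i : ℕ} (hi : i < a) (f : ℕ → ℝ) (c : ℝ) :
    (((List.range a).map f).insertionSort (· ≤ ·)).getD i 0 ≤ c ↔
      i < ((Finset.range a).filter fun l => f l ≤ c).card := by
  have hsorted := List.pairwise_insertionSort (· ≤ ·) ((List.range a).map f)
  have hlen : (((List.range a).map f).insertionSort (· ≤ ·)).length = a := by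
    rw [List.length_insertionSort, List.length_map, List.length_range]
  have hle := countP_insertionSort_map_range a f (· ≤ c)
  have hlt := countP_insertionSort_map_range a f (c < ·)
  set L := ((List.range a).map f).insertionSort (· ≤ ·)
  have hsplit := Finset.card_filter_add_card_filter_not (s := Finset.range a) (fun l => f l ≤ c)
  simp only [not_le, Finset.card_range] at hsplit
  refine ⟨fun h => hle ▸ succ_le_countP hsorted (hlen.symm ▸ hi) fun x hx =>
    decide_eq_true (hx.trans h), fun h => le_of_not_gt fun hc => ?_⟩
  have := length_sub_le_countP (p := fun x => decide (c < x)) hsorted fun x hx =>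
    decide_eq_true (hc.trans_le hx)
  omega

lemma measurable_getD_insertionSort {Ω : Type*} [MeasurableSpace Ω] {a i : ℕ} (hi : i < a)
    {f : Ω → ℕ → ℝ} (hf : Measurable f) :
    Measurable fun ω => (((List.range a).map (f ω)).insertionSort (· ≤ ·)).getD i 0 := by
  refine measurable_of_Iic fun c => ?_
  simp only [Set.preimage, Set.mem_Iic, getD_insertionSort_le_iff hi, Finset.card_filter]
  refine measurableSet_lt measurable_const (Finset.measurable_fun_sum _ fun l _ => ?_)
  exact Measurable.ite (measurableSet_le (by fun_prop) measurable_const) measurable_const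
    measurable_const

lemma measurable_median (a : ℕ) : Measurable (median a) := by
  rcases a.eq_zero_or_pos with rfl | ha
  · have : median 0 = fun _ => 0 := funext fun f => by simp [median]
    exact this ▸ measurable_const
  · exact ((measurable_getD_insertionSort (by omega) measurable_id).add
      (measurable_getD_insertionSort (by omega) measurable_id)).div_const 2

end Median

section Independence

variable {Ω ι κ 𝓧 : Type*} {mΩ : MeasurableSpace Ω} [MeasurableSpace 𝓧] {P : Measure Ω}

lemma hasLaw_infinitePi_map {X : ι → Ω → 𝓧} (hX : ∀ i, Measurable (X i)) (hind : iIndepFun X P) :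
    HasLaw (fun ω i => X i ω) (Measure.infinitePi fun i => P.map (X i)) P :=
  hind.hasLaw_infinitePi (fun i => ⟨(hX i).aemeasurable, rfl⟩)
    (measurable_pi_lambda _ hX).aemeasurable

lemma iIndepFun_curry {X : ι × κ → Ω → 𝓧} (hX : ∀ p, Measurable (X p)) (hind : iIndepFun X P) :
    iIndepFun (fun i ω j => X (i, j) ω) P := by
  have := hind.isProbabilityMeasure
  have hlaw (p : ι × κ) : IsProbabilityMeasure (P.map (X p)) :=
    Measure.isProbabilityMeasure_map (hX p).aemeasurable
  have hrow : ∀ i, HasLaw (fun ω j => X (i, j) ω)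
      (Measure.infinitePi fun j => P.map (X (i, j))) P := fun i =>
    hasLaw_infinitePi_map (fun j => hX (i, j)) (hind.precomp (Prod.mk_right_injective i))
  refine (iIndepFun_iff_hasLaw_Pi_infinitePi hrow
    (measurable_pi_lambda _ fun i => measurable_pi_lambda _ fun j => hX (i, j)).aemeasurable).2 ?_
  rw [← Measure.infinitePi_map_curry fun i j => P.map (X (i, j))]
  exact HasLaw.comp ⟨(MeasurableEquiv.curry ι κ 𝓧).measurable.aemeasurable, rfl⟩
    (hasLaw_infinitePi_map hX hind)

end Independence

section MedianOfMeans

variable {Ω : Type*} {mΩ : MeasurableSpace Ω} {P : Measure Ω}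

lemma measureReal_mul_card_le_card_filter_le {ι 𝓧 : Type*} [MeasurableSpace 𝓧] {W : ι → Ω → 𝓧}
    (hW : ∀ l, Measurable (W l)) (hind : iIndepFun W P) {B : Set 𝓧} (hB : MeasurableSet B)
    [DecidablePred (· ∈ B)] {p q : ℝ} (hp : ∀ l, P.real (W l ⁻¹' B) ≤ p) (hpq : p ≤ q)
    (s : Finset ι) :
    P.real {ω | q * s.card ≤ (s.filter fun l => W l ω ∈ B).card} ≤
      Real.exp (-2 * s.card * (q - p) ^ 2) := by
  have := hind.isProbabilityMeasure
  set I : 𝓧 → ℝ := B.indicator 1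
  have hI : Measurable I := measurable_one.indicator hB
  have hE : ∀ l, ∫ ω, I (W l ω) ∂P ≤ p := fun l => by
    refine le_trans (le_of_eq ?_) (hp l)
    rw [← integral_indicator_one (hW l hB)]
    rfl
  have hcount : ∀ ω, ∑ l ∈ s, I (W l ω) = (s.filter fun l => W l ω ∈ B).card := fun ω => by
    simp only [I, Set.indicator_apply, Pi.one_apply, Finset.sum_boole]
  have hsub : ∀ l, HasSubgaussianMGF (fun ω => I (W l ω) - ∫ ω, I (W l ω) ∂P)
      ((‖(1 : ℝ) - 0‖₊ / 2) ^ 2) P := fun l =>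
    hasSubgaussianMGF_of_mem_Icc (hI.comp (hW l)).aemeasurable
      (ae_of_all _ fun ω => ⟨Set.indicator_nonneg (fun _ _ => zero_le_one) _,
        Set.indicator_le_self' (fun _ _ => zero_le_one) _⟩)
  have hhoeffding := HasSubgaussianMGF.measure_sum_ge_le_of_iIndepFun (s := s)
    (hind.comp (fun l x => I x - ∫ ω, I (W l ω) ∂P) fun l => by fun_prop)
    (fun l _ => hsub l) (ε := s.card * (q - p)) (mul_nonneg (Nat.cast_nonneg _) (sub_nonneg.2 hpq))
  refine (measureReal_mono fun ω hω => ?_).trans (hhoeffding.trans_eq ?_)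
  · have hmean : ∑ l ∈ s, ∫ ω, I (W l ω) ∂P ≤ s.card * p := by
      simpa only [nsmul_eq_mul] using s.sum_le_card_nsmul _ _ fun l _ => hE l
    simp only [Set.mem_ofPred_eq, Function.comp_apply, Finset.sum_sub_distrib, hcount] at hω ⊢
    linarith
  · have hquarter : (((‖(1 : ℝ) - 0‖₊ / 2) ^ 2 : ℝ≥0) : ℝ) = 1 / 4 := by norm_num
    congr 1
    rw [Finset.sum_const, nsmul_eq_mul, NNReal.coe_mul, NNReal.coe_natCast, hquarter]
    rcases s.card.eq_zero_or_pos with hs | hs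
    · simp [hs]
    · field_simp
      norm_num

/-- The mean of the entries of `y` in the `l`-th block of length `b`. -/
noncomputable def blockMean (b : ℕ) (y : ℕ → ℝ) (l : ℕ) : ℝ :=
  (1 / (b : ℝ)) * ∑ j ∈ Finset.range b, y (l * b + j)

lemma measurable_blockMean (b l : ℕ) : Measurable fun y => blockMean b y l := by
  unfold blockMean
  fun_prop

variable {Y : ℕ → Ω → ℝ}

lemma iIndepFun_blockMean (hY : ∀ j, Measurable (Y j)) (hind : iIndepFun Y P) (b : ℕ) :
    iIndepFun (fun l ω => blockMean b (fun j => Y j ω) l) P := by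
  have hinj : Function.Injective fun p : ℕ × Fin b => p.1 * b + p.2 := by
    rintro ⟨l, i⟩ ⟨l', j⟩ h
    have hb : NeZero b := ⟨i.pos.ne'⟩
    exact (Nat.divModEquiv b).symm.injective h
  have hblocks := (iIndepFun_curry (fun p => hY _) (hind.precomp hinj)).comp
    (fun _ u => (1 / (b : ℝ)) * ∑ j, u j) fun _ => by fun_prop
  convert hblocks using 3 with l ω
  simp only [blockMean, Finset.sum_range, Function.comp_apply]

variable {C V : ℝ} {b : ℕ}

lemma integral_blockMean [IsFiniteMeasure P] (hY : ∀ j, MemLp (Y j) 2 P)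
    (hC : ∀ j, ∫ ω, Y j ω ∂P = C) (hb : 0 < b) (l : ℕ) :
    ∫ ω, blockMean b (fun j => Y j ω) l ∂P = C := by
  have hb0 : (b : ℝ) ≠ 0 := by exact_mod_cast hb.ne'
  simp only [blockMean]
  rw [integral_const_mul, integral_finsetSum _ fun j _ => (hY _).integrable one_le_two]
  simp only [hC, Finset.sum_const, Finset.card_range, nsmul_eq_mul]
  field_simp

lemma variance_blockMean_le (hY : ∀ j, MemLp (Y j) 2 P) (hind : iIndepFun Y P)
    (hV : ∀ j, variance (Y j) P ≤ V) (hb : 0 < b) (l : ℕ) :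
    variance (fun ω => blockMean b (fun j => Y j ω) l) P ≤ V / b := by
  have : (0 : ℝ) < b := by exact_mod_cast hb
  have hsum : variance (fun ω => ∑ j ∈ Finset.range b, Y (l * b + j) ω) P ≤ b * V := by
    rw [← Finset.sum_fn, IndepFun.variance_sum (fun j _ => hY _)
      fun i _ j _ hij => hind.indepFun (by simpa using hij)]
    simpa using (Finset.range b).sum_le_card_nsmul _ _ fun j _ => hV (l * b + j)
  calc variance (fun ω => blockMean b (fun j => Y j ω) l) P
      = (1 / (b : ℝ)) ^ 2 * variance (fun ω => ∑ j ∈ Finset.range b, Y (l * b + j) ω) P :=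
        variance_const_mul _ _ _
    _ ≤ (1 / (b : ℝ)) ^ 2 * (b * V) := by gcongr
    _ = V / b := by field_simp

lemma measureReal_lt_abs_blockMean_sub_le (hY : ∀ j, MemLp (Y j) 2 P) (hind : iIndepFun Y P)
    (hC : ∀ j, ∫ ω, Y j ω ∂P = C) (hV : ∀ j, variance (Y j) P ≤ V) (hb : 0 < b) {w : ℝ}
    (hw : 0 < w) (l : ℕ) :
    P.real {ω | w < |blockMean b (fun j => Y j ω) l - C|} ≤ V / (b * w ^ 2) := by
  have := hind.isProbabilityMeasure
  have : (0 : ℝ) < b := by exact_mod_cast hb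
  have hV0 : 0 ≤ V := (variance_nonneg _ _).trans (hV 0)
  have hmem : MemLp (fun ω => blockMean b (fun j => Y j ω) l) 2 P :=
    (memLp_finsetSum _ fun j _ => hY (l * b + j)).const_mul _
  have hchebyshev := meas_ge_le_variance_div_sq hmem hw
  rw [integral_blockMean hY hC hb] at hchebyshev
  refine ENNReal.toReal_le_of_le_ofReal (by positivity) ((measure_mono fun ω hω => ?_).trans
    (hchebyshev.trans (ENNReal.ofReal_le_ofReal ?_)))
  · exact (Set.mem_ofPred_eq .. ▸ hω).le
  · rw [← div_div]
    gcongr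
    exact variance_blockMean_le hY hind hV hb l

lemma measureReal_lt_abs_median_blockMean_sub_le (hYm : ∀ j, Measurable (Y j))
    (hY : ∀ j, MemLp (Y j) 2 P) (hind : iIndepFun Y P) (hC : ∀ j, ∫ ω, Y j ω ∂P = C)
    (hV : ∀ j, variance (Y j) P ≤ V) (hb : 0 < b) {w : ℝ} (hw : 0 < w)
    (hbw : 4 * V ≤ b * w ^ 2) (a : ℕ) :
    P.real {ω | w < |median a (blockMean b fun j => Y j ω) - C|} ≤ Real.exp (-a / 8) := by
  classical
  have := hind.isProbabilityMeasure
  have hB : MeasurableSet {x : ℝ | w < |x - C|} := measurableSet_lt measurable_const (by fun_prop)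
  have hquarter : ∀ l, P.real {ω | w < |blockMean b (fun j => Y j ω) l - C|} ≤ 1 / 4 := fun l => by
    refine (measureReal_lt_abs_blockMean_sub_le hY hind hC hV hb hw l).trans ?_
    rw [div_le_iff₀ (by positivity)]
    linarith
  have hhalf := measureReal_mul_card_le_card_filter_le
    (fun l => (measurable_blockMean b l).comp (measurable_pi_lambda _ hYm))
    (iIndepFun_blockMean hYm hind b) hB hquarter (by norm_num : (1 / 4 : ℝ) ≤ 1 / 2)
    (Finset.range a)
  refine (measureReal_mono fun ω hω => ?_).trans (hhalf.trans_eq ?_)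
  · have hcard := (Nat.cast_le (α := ℝ)).2 (le_two_mul_card_of_lt_abs_median a _ C w hω)
    push_cast at hcard
    simp only [Set.mem_ofPred_eq, Finset.card_range, Function.comp_apply] at hcard ⊢
    linarith
  · congr 1
    rw [Finset.card_range]
    ring

end MedianOfMeans

section GroupSums

lemma member_lt_member (N : ℕ → ℕ) {j j' i i' : ℕ} (hj : j < j') (hi : i < N j) :
    member N j i < member N j' i' := by
  have hle : ∑ l ∈ Finset.range (j + 1), N l ≤ ∑ l ∈ Finset.range j', N l :=
    Finset.sum_le_sum_of_subset (Finset.range_subset_range.2 hj)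
  rw [Finset.sum_range_succ] at hle
  unfold member
  omega

lemma member_inj (N : ℕ → ℕ) {j j' i i' : ℕ} (hi : i < N j) (hi' : i' < N j')
    (h : member N j i = member N j' i') : j = j' ∧ i = i' := by
  rcases lt_trichotomy j j' with hlt | rfl | hlt
  · exact absurd h (member_lt_member N hlt hi).ne
  · exact ⟨rfl, Nat.add_left_cancel h⟩
  · exact absurd h (member_lt_member N hlt hi').ne'

lemma measurable_member (j i : ℕ) {Ω : Type*} [MeasurableSpace Ω] {N : Ω → ℕ → ℕ}
    (hN : Measurable N) : Measurable fun ω => member (N ω) j i := by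
  unfold member
  fun_prop

variable {r k : ℕ}

/-- The sum of the hash values of group `j` in a round whose first user has the number `U`. -/
def hashSum (U : ℕ) (N : ℕ → ℕ) (h : Hash r k) (s : ℕ → Fin r) (x : ℕ → Fin k) (j : ℕ) : ℤ :=
  ∑ i ∈ Finset.range (N j), (h (j, s (U + member N j i), x (U + member N j i)) : ℤ)

lemma measurable_hashSum {Ω : Type*} [MeasurableSpace Ω] {U : Ω → ℕ} {N : Ω → ℕ → ℕ}
    {h : Ω → Hash r k} {s : Ω → ℕ → Fin r} {x : Ω → ℕ → Fin k} (hU : Measurable U)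
    (hN : Measurable N) (hh : Measurable h) (hs : Measurable s) (hx : Measurable x) (j : ℕ) :
    Measurable fun ω => hashSum (U ω) (N ω) (h ω) (s ω) (x ω) j := by
  have hterm : ∀ i, Measurable fun ω => (h ω (j, s ω (U ω + member (N ω) j i),
      x ω (U ω + member (N ω) j i)) : ℤ) := fun i => by
    have hu : Measurable fun ω => U ω + member (N ω) j i := hU.add (measurable_member j i hN)
    exact (Measurable.of_discrete (f := fun u : ℤˣ => (u : ℤ))).comp
      (measurable_eval_at hh (measurable_const.prodMk
        ((measurable_eval_at hs hu).prodMk (measurable_eval_at hx hu))))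
  exact measurable_eval_at (f := fun ω n => ∑ i ∈ Finset.range n, (h ω (j, s ω (U ω +
    member (N ω) j i), x ω (U ω + member (N ω) j i)) : ℤ)) (by fun_prop) (by fun_prop)

lemma infinitePi_map_sigma_of_injective {ι κ X : Type*} {σ : κ → Type*} [MeasurableSpace X]
    (ν : Measure X) [IsProbabilityMeasure ν] {f : (Σ j, σ j) → ι} (hf : f.Injective) :
    (Measure.infinitePi fun _ : ι => ν).map (fun ω j i => ω (f ⟨j, i⟩)) =
      Measure.infinitePi fun j => Measure.infinitePi fun _ : σ j => ν := by
  rw [← Measure.infinitePi_map_piCurry fun j (_ : σ j) => ν,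
    ← Measure.map_infinitePi_infinitePi_of_inj (P := fun _ : ι => ν) hf,
    Measure.map_map (by fun_prop) (by fun_prop)]
  rfl

variable (q₁ : Measure (Fin r)) [IsProbabilityMeasure q₁] (q₂ : Measure (Fin k))
  [IsProbabilityMeasure q₂] (t U : ℕ) (N : ℕ → ℕ)

lemma map_groupData :
    ((signLaw (ℕ × ℕ × Fin r × Fin k)).prod
      ((Measure.infinitePi fun _ : ℕ => q₁).prod (Measure.infinitePi fun _ : ℕ => q₂))).map
      (fun z j => ((fun a => z.1 (t, j, a), fun i =>
        (z.2.1 (U + member N j i), z.2.2 (U + member N j i))) :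
          (Fin r × Fin k → ℤˣ) × (Fin (N j) → Fin r × Fin k))) =
    Measure.infinitePi fun j => (signLaw (Fin r × Fin k)).prod
      (Measure.infinitePi fun _ : Fin (N j) => q₁.prod q₂) := by
  have hrow : Function.Injective fun p : (Σ _ : ℕ, Fin r × Fin k) => (t, p.1, p.2) := by
    rintro ⟨j, a⟩ ⟨j', a'⟩ h
    simp only [Prod.mk.injEq, true_and] at h
    obtain ⟨rfl, rfl⟩ := h
    rfl
  have huser : Function.Injective fun p : (Σ j : ℕ, Fin (N j)) => U + member N p.1 p.2 := by
    rintro ⟨j, i⟩ ⟨j', i'⟩ h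
    obtain ⟨rfl, hi⟩ := member_inj N i.2 i'.2 (Nat.add_left_cancel h)
    rw [Fin.ext hi]
  rw [← infinitePi_prod_map_zip, ← infinitePi_map_sigma_of_injective (q₁.prod q₂) huser]
  unfold signLaw
  rw [← infinitePi_map_sigma_of_injective (uniformOn (Set.univ : Set ℤˣ)) hrow,
    ← infinitePi_prod_map_zip, Measure.map_map (by fun_prop) (by fun_prop),
    Measure.map_prod_map _ _ (by fun_prop) (by fun_prop),
    Measure.map_map (by fun_prop) (by fun_prop)]
  rfl

lemma measure_forall_hashSum_mem (S : Finset ℕ) (B : ℕ → Set ℤ) :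
    ((signLaw (ℕ × ℕ × Fin r × Fin k)).prod
      ((Measure.infinitePi fun _ : ℕ => q₁).prod (Measure.infinitePi fun _ : ℕ => q₂)))
      {z | ∀ j ∈ S, hashSum U N (fun a => z.1 (t, a)) z.2.1 z.2.2 j ∈ B j} =
    ∏ j ∈ S, ((signLaw (Fin r × Fin k)).prod (Measure.infinitePi fun _ : Fin (N j) => q₁.prod q₂))
      {z | ∑ i, (z.1 (z.2 i) : ℤ) ∈ B j} := by
  have hm : ∀ j, MeasurableSet {z : (Fin r × Fin k → ℤˣ) × (Fin (N j) → Fin r × Fin k) |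
      ∑ i, (z.1 (z.2 i) : ℤ) ∈ B j} := fun j => .of_discrete
  rw [← Measure.infinitePi_pi _ fun j _ => hm j, ← map_groupData q₁ q₂ t U N,
    Measure.map_apply (by fun_prop) (.pi S.countable_toSet fun j _ => hm j)]
  congr 1
  ext z
  simp [hashSum, Finset.sum_range]

end GroupSums

section RoundLaw

variable {k : ℕ} (p : PMF (Fin k)) (α β δ : ℝ)

/-- The law of a salted sample. -/
noncomputable def saltedLaw : Measure (Fin (numSalts α β) × Fin k) :=
  (uniformOn Set.univ).prod p.toMeasure

instance : IsProbabilityMeasure (saltedLaw p α β) := by unfold saltedLaw; infer_instance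

/-- The law of the sizes of the groups of all rounds. -/
noncomputable def sizeLaw : Measure (ℕ × ℕ → ℕ) :=
  Measure.infinitePi fun q => poissonMeasure (roundRate α β δ q.1).toNNReal

instance : IsProbabilityMeasure (sizeLaw α β δ) := by unfold sizeLaw; infer_instance

/-- The law of the salts of all users. -/
noncomputable def saltLaw (r : ℕ) [NeZero r] : Measure (ℕ → Fin r) :=
  Measure.infinitePi fun _ => uniformOn Set.univ

instance (r : ℕ) [NeZero r] : IsProbabilityMeasure (saltLaw r) := by
  unfold saltLaw
  infer_instance

lemma prod_prod_prod_eq_map {A B C D : Type*} [MeasurableSpace A] [MeasurableSpace B]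
    [MeasurableSpace C] [MeasurableSpace D] (a : Measure A) [SFinite a] (b : Measure B) [SFinite b]
    (c : Measure C) [SFinite c] (d : Measure D) [SFinite d] :
    (a.prod (b.prod c)).prod d =
      (a.prod (b.prod (c.prod d))).map fun z => ((z.1, z.2.1, z.2.2.1), z.2.2.2) :=
  (((measurePreserving_prodAssoc a (b.prod c) d).symm _).comp
    ((MeasurePreserving.id a).prod ((measurePreserving_prodAssoc b c d).symm _))).map_eq.symm

lemma fullLaw_eq_map : fullLaw p α β δ =
    ((sizeLaw α β δ).prod ((signLaw (ℕ × ℕ × Fin (numSalts α β) × Fin k)).prod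
      ((saltLaw (numSalts α β)).prod (Measure.infinitePi fun _ : ℕ => p.toMeasure)))).map
      fun z => ((z.1, z.2.1, z.2.2.1), z.2.2.2) :=
  prod_prod_prod_eq_map _ _ _ _

lemma measurable_usersBefore (t : ℕ) :
    Measurable fun ω : Seed (numSalts α β) k => usersBefore α β δ ω t := by
  unfold usersBefore
  fun_prop

/-- The sums of the hash values of the groups of round `t`. -/
noncomputable def roundSums {α β : ℝ} (δ : ℝ) (t : ℕ)
    (ω : Seed (numSalts α β) k × (ℕ → Fin k)) (j : ℕ) : ℤ :=
  hashSum (usersBefore α β δ ω.1 t) (fun j => ω.1.1 (t, j)) (fun q => ω.1.2.1 (t, q))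
    ω.1.2.2 ω.2 j

lemma measurable_roundSums (t : ℕ) : Measurable fun
    (ω : Seed (numSalts α β) k × (ℕ → Fin k)) => roundSums δ t ω :=
  measurable_pi_lambda _ fun j => measurable_hashSum
    ((measurable_usersBefore α β δ t).comp measurable_fst) (by fun_prop) (by fun_prop)
    (by fun_prop) (by fun_prop) j

lemma fullLaw_forall_roundSums_mem (t : ℕ) (S : Finset ℕ) (B : ℕ → Set ℤ) :
    fullLaw p α β δ {ω | ∀ j ∈ S, roundSums δ t ω j ∈ B j} =
      ∫⁻ N, ∏ j ∈ S, ((signLaw (Fin (numSalts α β) × Fin k)).prod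
        (Measure.infinitePi fun _ : Fin (N (t, j)) => saltedLaw p α β))
          {z | ∑ i, (z.1 (z.2 i) : ℤ) ∈ B j} ∂sizeLaw α β δ := by
  have hA : MeasurableSet {ω : Seed (numSalts α β) k × (ℕ → Fin k) |
      ∀ j ∈ S, roundSums δ t ω j ∈ B j} :=
    measurable_roundSums α β δ t (.pi S.countable_toSet fun j _ => .of_discrete)
  have hφ : Measurable fun z : (ℕ × ℕ → ℕ) × (ℕ × ℕ × Fin (numSalts α β) × Fin k → ℤˣ) ×
      (ℕ → Fin (numSalts α β)) × (ℕ → Fin k) =>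
      (((z.1, z.2.1, z.2.2.1), z.2.2.2) : Seed (numSalts α β) k × (ℕ → Fin k)) := by fun_prop
  rw [fullLaw_eq_map, Measure.map_apply hφ hA, Measure.prod_apply (hφ hA)]
  exact lintegral_congr fun N => measure_forall_hashSum_mem _ _ t
    (∑ u ∈ Finset.range t, ∑ j ∈ Finset.range (roundGroups α β δ u), N (u, j))
    (fun j => N (t, j)) S B

lemma map_roundSums (t : ℕ) :
    (fullLaw p α β δ).map (roundSums δ t) =
      Measure.infinitePi fun _ : ℕ => sumLaw (roundRate α β δ t).toNNReal (saltedLaw p α β) := by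
  refine Measure.eq_infinitePi _ fun S B hB => ?_
  set F : ℕ → ℕ → ENNReal := fun j n => ((signLaw (Fin (numSalts α β) × Fin k)).prod
    (Measure.infinitePi fun _ : Fin n => saltedLaw p α β)) {z | ∑ i, (z.1 (z.2 i) : ℤ) ∈ B j}
  have hrow : (sizeLaw α β δ).map (fun N j => N (t, j)) =
      Measure.infinitePi fun _ => poissonMeasure (roundRate α β δ t).toNNReal :=
    Measure.map_infinitePi_infinitePi_of_inj (Prod.mk_right_injective t)
  calc (fullLaw p α β δ).map (roundSums δ t) (Set.pi S B)
      = ∫⁻ N, ∏ j ∈ S, F j (N (t, j)) ∂sizeLaw α β δ := by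
        rw [Measure.map_apply (measurable_roundSums α β δ t)
          (.pi S.countable_toSet fun i _ => hB i)]
        exact fullLaw_forall_roundSums_mem p α β δ t S B
    _ = ∫⁻ n, ∏ j ∈ S, F j (n j)
          ∂Measure.infinitePi fun _ => poissonMeasure (roundRate α β δ t).toNNReal := by
        rw [← hrow, lintegral_map _ (by fun_prop)]
        exact Finset.measurable_fun_prod _ fun j _ =>
          (measurable_from_top (f := F j)).comp (measurable_pi_apply j)
    _ = ∏ j ∈ S, sumLaw (roundRate α β δ t).toNNReal (saltedLaw p α β) (B j) := by
        rw [lintegral_prod_infinitePi _ S fun j => measurable_from_top]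
        simp only [F, sumLaw_apply]

lemma hasLaw_roundSums (t j : ℕ) : HasLaw (fun ω => roundSums δ t ω j)
    (sumLaw (roundRate α β δ t).toNNReal (saltedLaw p α β)) (fullLaw p α β δ) := by
  refine HasLaw.comp (Y := fun v : ℕ → ℤ => v j) (X := roundSums δ t)
    ⟨(measurable_pi_apply j).aemeasurable, ?_⟩
    ⟨(measurable_roundSums α β δ t).aemeasurable, map_roundSums p α β δ t⟩
  exact Measure.infinitePi_map_eval _ j

lemma iIndepFun_roundSums (t : ℕ) :
    iIndepFun (fun j ω => roundSums δ t ω j) (fullLaw p α β δ) :=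
  (iIndepFun_iff_hasLaw_Pi_infinitePi (hasLaw_roundSums p α β δ t)
    (measurable_roundSums α β δ t).aemeasurable).2
    ⟨(measurable_roundSums α β δ t).aemeasurable, map_roundSums p α β δ t⟩

end RoundLaw

section Parameters

variable {α β δ : ℝ}

lemma one_le_numSalts (α β : ℝ) : (1 : ℝ) ≤ numSalts α β := by
  exact_mod_cast le_max_left _ _

lemma failProb_pos (hδ : 0 < δ) (t : ℕ) : 0 < failProb δ t := by
  unfold failProb
  positivity

lemma tsum_ofReal_failProb (hδ : 0 < δ) :
    ∑' t, ENNReal.ofReal (failProb δ t) = ENNReal.ofReal δ := by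
  have hsum : HasSum (failProb δ) δ :=
    (hasSum_geometric_two' δ).congr_fun fun t => by
      unfold failProb
      rw [pow_succ]
      field_simp
  rw [← ENNReal.ofReal_tsum_of_nonneg (fun t => (failProb_pos hδ t).le) hsum.summable, hsum.tsum_eq]

lemma log_one_div_failProb (hδ : 0 < δ) (t : ℕ) :
    Real.log (1 / failProb δ t) = Real.log (1 / δ) + (t + 1) * Real.log 2 := by
  have h : 1 / failProb δ t = (1 / δ) * 2 ^ (t + 1) := by
    unfold failProb
    field_simp
  rw [h, Real.log_mul (by positivity) (by positivity), Real.log_pow]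
  push_cast
  ring

lemma log_one_div_nonneg (hδ : 0 < δ) (hδ1 : δ ≤ 1) : 0 ≤ Real.log (1 / δ) :=
  Real.log_nonneg ((one_le_div hδ).2 hδ1)

lemma six_le_roundSupergroups (hδ : 0 < δ) (hδ1 : δ ≤ 1) (t : ℕ) : 6 ≤ roundSupergroups δ t := by
  have hlog : 0 ≤ Real.log (1 / δ) := log_one_div_nonneg hδ hδ1
  have ht : (0 : ℝ) ≤ t * Real.log 2 := by positivity
  unfold roundSupergroups numSupergroups
  rw [log_one_div_failProb hδ]
  refine Nat.succ_le_of_lt (Nat.lt_ceil.2 ?_)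
  push_cast
  linarith [Real.log_two_gt_d9]

lemma roundSupergroups_le_mul (hδ : 0 < δ) (hδ1 : δ ≤ 1) (t : ℕ) :
    roundSupergroups δ t ≤ roundSupergroups δ 0 * (1 + t) := by
  have h6 : (6 : ℝ) ≤ roundSupergroups δ 0 := by exact_mod_cast six_le_roundSupergroups hδ hδ1 0
  have h0 : 8 * Real.log (1 / failProb δ 0) ≤ roundSupergroups δ 0 := Nat.le_ceil _
  have ht : (0 : ℝ) ≤ t := t.cast_nonneg
  conv_lhs => unfold roundSupergroups numSupergroups
  rw [Nat.ceil_le]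
  rw [log_one_div_failProb hδ] at h0 ⊢
  push_cast at h0 ⊢
  nlinarith [Real.log_two_lt_d9]

lemma exp_neg_roundSupergroups_le (hδ : 0 < δ) (t : ℕ) :
    Real.exp (-(roundSupergroups δ t : ℝ) / 8) ≤ failProb δ t := by
  have h : 8 * Real.log (1 / failProb δ t) ≤ roundSupergroups δ t := Nat.le_ceil _
  rw [one_div, Real.log_inv] at h
  rw [← Real.le_log_iff_exp_le (failProb_pos hδ t)]
  linarith

lemma sampleSize_pos (hδ : 0 < δ) (hδ1 : δ ≤ 1) (t : ℕ) : 0 < sampleSize α β δ t := by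
  have ha : 0 < numSupergroups (failProb δ 0) :=
    lt_of_lt_of_le (by norm_num) (six_le_roundSupergroups hδ hδ1 0)
  have hr : 0 < (numSalts α β : ℝ) := zero_lt_one.trans_le (one_le_numSalts α β)
  unfold sampleSize
  positivity

lemma radius_pos (hδ : 0 < δ) (hδ1 : δ ≤ 1) (t : ℕ) : 0 < radius α β δ t := by
  have hn : 0 < sampleSize α β δ t := sampleSize_pos hδ hδ1 t
  have ha : 0 < numSupergroups (failProb δ t) :=
    lt_of_lt_of_le (by norm_num) (six_le_roundSupergroups hδ hδ1 t)
  have hr : 0 < (numSalts α β : ℝ) := zero_lt_one.trans_le (one_le_numSalts α β)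
  unfold radius
  positivity

lemma radius_sq_mul_sampleSize (hδ : 0 < δ) (hδ1 : δ ≤ 1) (t : ℕ) :
    radius α β δ t ^ 2 * sampleSize α β δ t = 160 * roundSupergroups δ t * numSalts α β := by
  have hn : 0 < sampleSize α β δ t := sampleSize_pos hδ hδ1 t
  unfold radius
  rw [Real.sq_sqrt (by positivity), div_mul_cancel₀ _ hn.ne']
  rfl

lemma radius_sq_le (hδ : 0 < δ) (hδ1 : δ ≤ 1) (t : ℕ) :
    radius α β δ t ^ 2 ≤ (1 + t) / 2 ^ t := by
  have hn : 0 < sampleSize α β δ t := sampleSize_pos hδ hδ1 t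
  have ha : (roundSupergroups δ t : ℝ) ≤ roundSupergroups δ 0 * (1 + t) := by
    exact_mod_cast roundSupergroups_le_mul hδ hδ1 t
  refine le_of_mul_le_mul_right ?_ hn
  calc radius α β δ t ^ 2 * sampleSize α β δ t
      = 160 * roundSupergroups δ t * numSalts α β := radius_sq_mul_sampleSize hδ hδ1 t
    _ ≤ 160 * (roundSupergroups δ 0 * (1 + t)) * numSalts α β := by gcongr
    _ = (1 + t) / 2 ^ t * sampleSize α β δ t := by
      unfold sampleSize roundSupergroups
      field_simp

lemma radius_sq_le_one (hδ : 0 < δ) (hδ1 : δ ≤ 1) (t : ℕ) : radius α β δ t ^ 2 ≤ 1 := by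
  refine (radius_sq_le hδ hδ1 t).trans ((div_le_one (by positivity)).2 ?_)
  exact_mod_cast (add_comm 1 t).trans_le t.lt_two_pow_self

lemma twenty_le_roundGroupsPer_mul (hδ : 0 < δ) (hδ1 : δ ≤ 1) (t : ℕ) :
    20 ≤ (roundGroupsPer α β δ t : ℝ) * radius α β δ t ^ 2 := by
  have hw : 0 < radius α β δ t := radius_pos hδ hδ1 t
  rw [← div_le_iff₀ (by positivity)]
  exact Nat.le_ceil _

lemma roundGroupsPer_mul_le (hδ : 0 < δ) (hδ1 : δ ≤ 1) (t : ℕ) :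
    (roundGroupsPer α β δ t : ℝ) * radius α β δ t ^ 2 ≤ 21 := by
  have hw : 0 < radius α β δ t := radius_pos hδ hδ1 t
  calc (roundGroupsPer α β δ t : ℝ) * radius α β δ t ^ 2
      ≤ (20 / radius α β δ t ^ 2 + 1) * radius α β δ t ^ 2 := by
        gcongr
        exact (Nat.ceil_lt_add_one (by positivity)).le
    _ = 20 + radius α β δ t ^ 2 := by field_simp
    _ ≤ 21 := by linarith [radius_sq_le_one (α := α) (β := β) hδ hδ1 t]

lemma roundGroupsPer_pos (hδ : 0 < δ) (hδ1 : δ ≤ 1) (t : ℕ) : 0 < roundGroupsPer α β δ t := by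
  have hw : 0 < radius α β δ t := radius_pos hδ hδ1 t
  exact Nat.ceil_pos.2 (by positivity)

lemma roundGroups_pos (hδ : 0 < δ) (hδ1 : δ ≤ 1) (t : ℕ) : 0 < roundGroups α β δ t :=
  Nat.mul_pos (lt_of_lt_of_le (by norm_num) (six_le_roundSupergroups hδ hδ1 t))
    (roundGroupsPer_pos hδ hδ1 t)

lemma roundRate_pos (hδ : 0 < δ) (hδ1 : δ ≤ 1) (t : ℕ) : 0 < roundRate α β δ t :=
  div_pos (sampleSize_pos hδ hδ1 t) (Nat.cast_pos.2 (roundGroups_pos hδ hδ1 t))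

lemma numSalts_le_roundRate (hδ : 0 < δ) (hδ1 : δ ≤ 1) (t : ℕ) :
    160 * (numSalts α β : ℝ) ≤ 21 * roundRate α β δ t := by
  have hg : (0 : ℝ) < roundGroups α β δ t := Nat.cast_pos.2 (roundGroups_pos hδ hδ1 t)
  have hw : 0 < radius α β δ t ^ 2 := pow_pos (radius_pos hδ hδ1 t) 2
  unfold roundRate
  rw [← mul_div_assoc, le_div_iff₀ hg]
  refine le_of_mul_le_mul_left ?_ hw
  calc radius α β δ t ^ 2 * (160 * numSalts α β * roundGroups α β δ t)
      = (160 * roundSupergroups δ t * numSalts α β : ℝ) *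
          (roundGroupsPer α β δ t * radius α β δ t ^ 2) := by
        unfold roundGroups
        push_cast
        ring
    _ ≤ (160 * roundSupergroups δ t * numSalts α β : ℝ) * 21 := by
        gcongr
        exact roundGroupsPer_mul_le hδ hδ1 t
    _ = radius α β δ t ^ 2 * (21 * sampleSize α β δ t) := by
        rw [← radius_sq_mul_sampleSize hδ hδ1]
        ring

end Parameters

section RoundFailure

variable {k : ℕ} (p : PMF (Fin k)) {α β δ : ℝ}

lemma collisionProb_le_one : collisionProb p ≤ 1 := by
  have hsum : ∑ i, (p i).toReal = 1 := by
    rw [← ENNReal.toReal_sum fun i _ => p.apply_ne_top i, ← tsum_fintype (L := .unconditional _),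
      p.tsum_coe, ENNReal.toReal_one]
  rw [← hsum]
  exact Finset.sum_le_sum fun i _ => pow_le_of_le_one ENNReal.toReal_nonneg
    (ENNReal.toReal_mono ENNReal.one_ne_top (p.coe_le_one i)) two_ne_zero

lemma saltedLaw_real_singleton (z : Fin (numSalts α β) × Fin k) :
    (saltedLaw p α β).real {z} = (numSalts α β : ℝ)⁻¹ * (p z.2).toReal := by
  rw [saltedLaw, ← Prod.mk.eta (p := z), ← Set.singleton_prod_singleton, measureReal_prod_prod]
  congr 1
  · simp [Measure.real, uniformOn_univ]
  · rw [Measure.real, PMF.toMeasure_apply_singleton _ _ (measurableSet_singleton _)]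

lemma numSalts_mul_sum_sq_saltedLaw :
    numSalts α β * ∑ z, (saltedLaw p α β).real {z} ^ 2 = collisionProb p := by
  have hr : (numSalts α β : ℝ) ≠ 0 := NeZero.ne _
  simp only [saltedLaw_real_singleton, mul_pow, Fintype.sum_prod_type, ← Finset.mul_sum,
    Finset.sum_const, Finset.card_univ, Fintype.card_fin, nsmul_eq_mul, collisionProb]
  field_simp

lemma groupSum_roundTranscript (x : ℕ → Fin k) (ω : Seed (numSalts α β) k) (t j : ℕ)
    (hj : j < roundGroups α β δ t) :
    groupSum (roundTranscript α β δ x ω t) j = roundSums δ t (ω, x) j := by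
  unfold groupSum roundSums hashSum roundTranscript runTranscript
  push_cast
  simp only [hj, if_true, true_and]
  exact Finset.sum_congr rfl fun i hi => by rw [if_pos (Finset.mem_range.1 hi)]

lemma roundEstimate_eq_median (x : ℕ → Fin k) (ω : Seed (numSalts α β) k) (t : ℕ) :
    roundEstimate α β δ x ω t =
      median (roundSupergroups δ t) (blockMean (roundGroupsPer α β δ t) fun j =>
        sumEstimate (numSalts α β) (roundRate α β δ t) (roundSums δ t (ω, x) j)) := by
  refine median_congr fun l hl => ?_
  unfold blockMean
  congr 1
  refine Finset.sum_congr rfl fun j hj => ?_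
  have hlt : l * roundGroupsPer α β δ t + j < roundGroups α β δ t :=
    calc l * roundGroupsPer α β δ t + j < (l + 1) * roundGroupsPer α β δ t := by
          rw [add_one_mul]
          exact Nat.add_lt_add_left (Finset.mem_range.1 hj) _
      _ ≤ roundGroups α β δ t := Nat.mul_le_mul_right _ hl
  rw [groupEstimate, groupSum_roundTranscript x ω t _ hlt]
  rfl

lemma measureReal_radius_lt_le (hδ : 0 < δ) (hδ1 : δ ≤ 1) (t : ℕ) :
    (fullLaw p α β δ).real
        {ω | radius α β δ t < |roundEstimate α β δ ω.2 ω.1 t - collisionProb p|} ≤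
      failProb δ t := by
  set m : ℝ≥0 := (roundRate α β δ t).toNNReal
  set q := saltedLaw p α β
  set G : ℤ → ℝ := sumEstimate (numSalts α β) m
  have hrate : (m : ℝ) = roundRate α β δ t := Real.coe_toNNReal _ (roundRate_pos hδ hδ1 t).le
  have hG : Measurable G := measurable_from_top
  have hlaw := hasLaw_roundSums p α β δ t
  have hL : ∀ j, MemLp (fun ω => G (roundSums δ t ω j)) 2 (fullLaw p α β δ) := fun j =>
    (memLp_map_measure_iff hG.aestronglyMeasurable (hlaw j).aemeasurable).1
      ((hlaw j).map_eq ▸ memLp_sumEstimate m q _)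
  have hC : ∀ j, ∫ ω, G (roundSums δ t ω j) ∂fullLaw p α β δ = collisionProb p := fun j => by
    rw [← numSalts_mul_sum_sq_saltedLaw p,
      ← integral_sumEstimate m q _ (Real.toNNReal_pos.2 (roundRate_pos hδ hδ1 t))]
    exact (hlaw j).integral_comp hG.aestronglyMeasurable
  have hV : ∀ j, variance (fun ω => G (roundSums δ t ω j)) (fullLaw p α β δ) ≤ 5 := fun j => by
    have h5 : variance G (sumLaw m q) ≤ 5 := variance_sumEstimate_le_five m q _
      (by exact_mod_cast one_le_numSalts α β) (hrate ▸ numSalts_le_roundRate hδ hδ1 t)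
      ((numSalts_mul_sum_sq_saltedLaw p).trans_le (collisionProb_le_one p))
    rwa [← (hlaw j).map_eq, variance_map hG.aemeasurable (hlaw j).aemeasurable] at h5
  have hmeas : ∀ j, Measurable fun ω => G (roundSums (k := k) δ t ω j) := fun j =>
    hG.comp ((measurable_pi_apply j).comp (measurable_roundSums α β δ t))
  simp only [roundEstimate_eq_median, ← hrate]
  refine (measureReal_lt_abs_median_blockMean_sub_le hmeas hL
    ((iIndepFun_roundSums p α β δ t).comp _ fun _ => hG) hC hV (roundGroupsPer_pos hδ hδ1 t)
    (radius_pos hδ hδ1 t) ?_ _).trans (exp_neg_roundSupergroups_le hδ t)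
  linarith [twenty_le_roundGroupsPer_mul (α := α) (β := β) hδ hδ1 t]

lemma measure_radius_lt_le (hδ : 0 < δ) (hδ1 : δ ≤ 1) (t : ℕ) :
    fullLaw p α β δ {ω | radius α β δ t < |roundEstimate α β δ ω.2 ω.1 t - collisionProb p|} ≤
      ENNReal.ofReal (failProb δ t) := by
  rw [← ofReal_measureReal]
  exact ENNReal.ofReal_le_ofReal (measureReal_radius_lt_le p hδ hδ1 t)

lemma ofReal_one_sub_le_measure {Ω : Type*} [MeasurableSpace Ω] {μ : Measure Ω}
    [IsProbabilityMeasure μ] {A B : Set Ω} (h : Aᶜ ⊆ B) (hδ : 0 ≤ δ)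
    (hB : μ B ≤ ENNReal.ofReal δ) : ENNReal.ofReal (1 - δ) ≤ μ A := by
  rw [ENNReal.ofReal_sub _ hδ, ENNReal.ofReal_one, tsub_le_iff_right]
  calc 1 = μ (A ∪ Aᶜ) := by rw [Set.union_compl_self, measure_univ]
    _ ≤ μ A + μ Aᶜ := measure_union_le _ _
    _ ≤ μ A + ENNReal.ofReal δ := by gcongr; exact (measure_mono h).trans hB

theorem ofReal_one_sub_le_measure_never_rejects (hδ : 0 < δ) (hδ1 : δ ≤ 1) :
    ENNReal.ofReal (1 - δ) ≤
      fullLaw p α β δ {ω | ∀ t, ¬ RejectsAt (collisionProb p) α β δ ω.2 ω.1 t} := by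
  refine ofReal_one_sub_le_measure (B := ⋃ t, {ω | Exceeds (collisionProb p) α β δ ω.2 ω.1 t})
    (fun ω hω => ?_) hδ.le ?_
  · simp only [Set.mem_compl_iff, Set.mem_ofPred_eq, not_forall, not_not] at hω
    obtain ⟨t, ht⟩ := hω
    exact Set.mem_iUnion.2 ⟨t, ht.1⟩
  · rw [← tsum_ofReal_failProb hδ]
    exact (measure_iUnion_le _).trans
      (ENNReal.tsum_le_tsum fun t => measure_radius_lt_le p hδ hδ1 t)

end RoundFailure

section UserCount

variable {k : ℕ} (p : PMF (Fin k)) {α β δ : ℝ}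

/-- The expected number of users in the rounds before round `t`. -/
noncomputable def expectedUsers (α β δ : ℝ) (t : ℕ) : ℝ :=
  ∑ u ∈ Finset.range t, sampleSize α β δ u

lemma expectedUsers_nonneg (hδ : 0 < δ) (hδ1 : δ ≤ 1) (t : ℕ) : 0 ≤ expectedUsers α β δ t :=
  Finset.sum_nonneg fun u _ => (sampleSize_pos hδ hδ1 u).le

lemma expectedUsers_succ_le (α β δ : ℝ) (t : ℕ) : expectedUsers α β δ (t + 1) ≤
    320 * roundSupergroups δ 0 * numSalts α β * 2 ^ t := by
  unfold expectedUsers sampleSize roundSupergroups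
  rw [← Finset.mul_sum, geom_sum_eq (by norm_num), pow_succ]
  have h : (0 : ℝ) ≤ 160 * numSupergroups (failProb δ 0) * numSalts α β := by positivity
  linarith

lemma log_two_div_le_expectedUsers (hδ : 0 < δ) (hδ1 : δ ≤ 1) (t : ℕ) :
    Real.log (2 / δ) ≤ expectedUsers α β δ (t + 1) := by
  have hfirst : sampleSize α β δ 0 ≤ expectedUsers α β δ (t + 1) :=
    Finset.single_le_sum (f := sampleSize α β δ) (fun u _ => (sampleSize_pos hδ hδ1 u).le)
      (Finset.mem_range.2 t.succ_pos)
  have ha : 8 * Real.log (1 / failProb δ 0) ≤ numSupergroups (failProb δ 0) := Nat.le_ceil _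
  rw [failProb, one_div_div, zero_add, pow_one] at ha
  have : 0 ≤ Real.log (2 / δ) := Real.log_nonneg ((one_le_div hδ).2 (by linarith))
  have hr : (1 : ℝ) ≤ numSalts α β := one_le_numSalts α β
  refine le_trans ?_ hfirst
  unfold sampleSize failProb
  rw [zero_add, pow_one]
  nlinarith

lemma hasLaw_usersBefore (hδ : 0 < δ) (hδ1 : δ ≤ 1) (t : ℕ) :
    HasLaw (fun ω => usersBefore α β δ ω.1 t)
      (poissonMeasure (expectedUsers α β δ t).toNNReal) (fullLaw p α β δ) := by
  set s := (Finset.range t).sigma fun u => Finset.range (roundGroups α β δ u)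
  have hsizes : HasLaw (fun ω => ω.1.1) (sizeLaw α β δ) (fullLaw p α β δ) :=
    ⟨by fun_prop, (measurePreserving_fst.comp measurePreserving_fst).map_eq⟩
  have hlaw : ∀ q : Σ _ : ℕ, ℕ, HasLaw (fun N : ℕ × ℕ → ℕ => N (q.1, q.2))
      (poissonMeasure (roundRate α β δ q.1).toNNReal) (sizeLaw α β δ) := fun q =>
    ⟨(measurable_pi_apply _).aemeasurable, Measure.infinitePi_map_eval _ (q.1, q.2)⟩
  have hind : iIndepFun (fun (q : Σ _ : ℕ, ℕ) (N : ℕ × ℕ → ℕ) => N (q.1, q.2)) (sizeLaw α β δ) :=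
    (iIndepFun_infinitePi (X := fun _ => id) fun _ => measurable_id).precomp
      (Equiv.sigmaEquivProd ℕ ℕ).injective
  have hsum := (hasLaw_sum_poissonMeasure (fun q => by fun_prop) hlaw hind s).comp hsizes
  have hmean : ∑ q ∈ s, (roundRate α β δ q.1).toNNReal = (expectedUsers α β δ t).toNNReal := by
    have hg : ∀ u, (roundGroups α β δ u : ℝ) ≠ 0 := fun u =>
      Nat.cast_ne_zero.2 (roundGroups_pos hδ hδ1 u).ne'
    rw [Finset.sum_sigma, expectedUsers,
      Real.toNNReal_sum_of_nonneg fun u _ => (sampleSize_pos hδ hδ1 u).le]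
    refine Finset.sum_congr rfl fun u _ => ?_
    simp only [Finset.sum_const]
    rw [Finset.card_range, nsmul_eq_mul, ← Real.toNNReal_natCast,
      ← Real.toNNReal_mul (Nat.cast_nonneg _), roundRate, mul_div_cancel₀ _ (hg u)]
  rw [hmean] at hsum
  convert hsum using 2 with ω
  exact (Finset.sum_sigma _ _ fun q : Σ _ : ℕ, ℕ => ω.1.1 (q.1, q.2)).symm

lemma measureReal_usersBefore_ge_le (hδ : 0 < δ) (hδ1 : δ ≤ 1) (t : ℕ) :
    (fullLaw p α β δ).real {ω | 4 * expectedUsers α β δ t ≤ usersBefore α β δ ω.1 t} ≤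
      Real.exp (-expectedUsers α β δ t) := by
  have hE := Real.coe_toNNReal _ (expectedUsers_nonneg (α := α) (β := β) hδ hδ1 t)
  have h := poissonMeasure_ge_four_mul_le (expectedUsers α β δ t).toNNReal
  rwa [hE, ← (hasLaw_usersBefore p hδ hδ1 t).measureReal_eq .of_discrete] at h

lemma usersBefore_mono (ω : Seed (numSalts α β) k) : Monotone (usersBefore α β δ ω) :=
  fun _ _ h => Finset.sum_le_sum_of_subset (Finset.range_subset_range.2 h)

end UserCount

section SampleBound

variable {k : ℕ} (p : PMF (Fin k)) {α β δ : ℝ}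

lemma two_mul_radius_lt (hδ : 0 < δ) (hδ1 : δ ≤ 1) {ε : ℝ} (hε : 0 < ε) {T : ℕ}
    (hT : 4 * (1 + T) < ε ^ 2 * 2 ^ T) : 2 * radius α β δ T < ε := by
  have hsq : radius α β δ T ^ 2 * 2 ^ T ≤ 1 + T :=
    (le_div_iff₀ (by positivity)).1 (radius_sq_le hδ hδ1 T)
  refine lt_of_pow_lt_pow_left₀ 2 hε.le
    (lt_of_mul_lt_mul_right (a := (2 : ℝ) ^ T) ?_ (by positivity))
  linarith

lemma rejectsWithin_of_exceeds {c₀ : ℝ} {x : ℕ → Fin k} {ω : Seed (numSalts α β) k} {T : ℕ}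
    (h : Exceeds c₀ α β δ x ω T) :
    RejectsWithin c₀ α β δ (usersBefore α β δ ω (T + 1)) x ω := by
  classical
  have hex : ∃ t, Exceeds c₀ α β δ x ω t := ⟨T, h⟩
  exact ⟨Nat.find hex, ⟨Nat.find_spec hex, fun u => Nat.find_min hex⟩,
    Nat.cast_le.2 (usersBefore_mono ω (Nat.succ_le_succ (Nat.find_min' hex h)))⟩

lemma RejectsWithin.mono {c₀ B B' : ℝ} {x : ℕ → Fin k} {ω : Seed (numSalts α β) k}
    (h : RejectsWithin c₀ α β δ B x ω) (hB : B ≤ B') : RejectsWithin c₀ α β δ B' x ω :=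
  h.imp fun _ ht => ⟨ht.1, ht.2.trans hB⟩

lemma exceeds_of_abs_sub_le {c c₀ ε : ℝ} (hc : ε ≤ |c - c₀|) {x : ℕ → Fin k}
    {ω : Seed (numSalts α β) k} {T : ℕ} (hw : 2 * radius α β δ T < ε)
    (h : |roundEstimate α β δ x ω T - c| ≤ radius α β δ T) : Exceeds c₀ α β δ x ω T := by
  have htri := abs_sub_le c (roundEstimate α β δ x ω T) c₀
  rw [abs_sub_comm c (roundEstimate _ _ _ _ _ _)] at htri
  unfold Exceeds
  linarith

lemma failProb_add_exp_le (hδ : 0 < δ) (hδ1 : δ ≤ 1) (t : ℕ) :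
    failProb δ t + Real.exp (-expectedUsers α β δ (t + 1)) ≤ δ := by
  have hfail : failProb δ t ≤ δ / 2 := by
    unfold failProb
    gcongr
    exact le_self_pow₀ (by norm_num) t.succ_ne_zero
  have hexp : Real.exp (-expectedUsers α β δ (t + 1)) ≤ δ / 2 := by
    rw [← Real.le_log_iff_exp_le (by positivity), ← inv_div, Real.log_inv]
    exact neg_le_neg (log_two_div_le_expectedUsers hδ hδ1 t)
  linarith

lemma ofReal_one_sub_le_measure_rejectsWithin (hδ : 0 < δ) (hδ1 : δ ≤ 1) {c₀ ε : ℝ} (hε : 0 < ε)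
    (h : ε ≤ |collisionProb p - c₀|) {T : ℕ} (hT : 4 * (1 + T) < ε ^ 2 * 2 ^ T) :
    ENNReal.ofReal (1 - δ) ≤ fullLaw p α β δ
      {ω | RejectsWithin c₀ α β δ (4 * expectedUsers α β δ (T + 1)) ω.2 ω.1} := by
  refine ofReal_one_sub_le_measure
    (B := {ω | radius α β δ T < |roundEstimate α β δ ω.2 ω.1 T - collisionProb p|} ∪
      {ω | 4 * expectedUsers α β δ (T + 1) ≤ usersBefore α β δ ω.1 (T + 1)}) ?_ hδ.le ?_
  · rw [Set.compl_subset_comm]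
    intro ω hω
    simp only [Set.mem_compl_iff, Set.mem_union, Set.mem_ofPred_eq, not_or, not_lt,
      not_le] at hω ⊢
    obtain ⟨hclose, hfew⟩ := hω
    exact (rejectsWithin_of_exceeds (exceeds_of_abs_sub_le h (two_mul_radius_lt hδ hδ1 hε hT)
      hclose)).mono hfew.le
  · rw [← ofReal_measureReal]
    exact ENNReal.ofReal_le_ofReal ((measureReal_union_le _ _).trans
      ((add_le_add (measureReal_radius_lt_le p hδ hδ1 T)
        (measureReal_usersBefore_ge_le p hδ hδ1 (T + 1))).trans (failProb_add_exp_le hδ hδ1 T)))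

end SampleBound

section FirstSuitableRound

lemma exists_four_mul_lt_mul_two_pow {c : ℝ} (hc : 0 < c) :
    ∃ T : ℕ, 4 * (1 + (T : ℝ)) < c * 2 ^ T := by
  have hlim : Filter.Tendsto (fun n : ℕ => (n : ℝ) ^ 1 / 2 ^ n) Filter.atTop (nhds 0) :=
    tendsto_pow_const_div_const_pow_of_one_lt 1 (by norm_num)
  obtain ⟨n, hn, hn1⟩ := ((hlim.eventually_lt_const (show 0 < c / 8 by positivity)).and
    (Filter.eventually_ge_atTop 1)).exists
  rw [div_lt_iff₀ (by positivity), pow_one] at hn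
  have hn1' : (1 : ℝ) ≤ n := Nat.one_le_cast.2 hn1
  exact ⟨n, by linarith⟩

lemma add_one_le_of_sq_mul_two_pow_le {ε : ℝ} (hε : 0 < ε) (hε1 : ε ≤ 1) {n : ℕ}
    (h : ε ^ 2 * 2 ^ n ≤ 4 * (1 + n)) : (n + 1 : ℝ) ≤ 6 + 5 * Real.log (1 / ε) := by
  have hdiv : (0 : ℝ) < (n + 1) / 4 := by positivity
  have hlog : Real.log (ε ^ 2 * 2 ^ n) ≤ Real.log (2 ^ 4 * ((n + 1) / 4)) :=
    Real.log_le_log (by positivity) (by linarith)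
  rw [Real.log_mul (by positivity) (by positivity), Real.log_mul (by positivity) hdiv.ne',
    Real.log_pow, Real.log_pow, Real.log_pow] at hlog
  have hlin := Real.log_le_sub_one_of_pos hdiv
  have hneg : Real.log ε ≤ 0 := Real.log_nonpos hε.le hε1
  have : (0 : ℝ) ≤ n := n.cast_nonneg
  rw [one_div, Real.log_inv]
  push_cast at hlog
  nlinarith [Real.log_two_gt_d9, Real.log_two_lt_d9]

lemma exists_four_mul_lt_and_two_pow_le {ε : ℝ} (hε : 0 < ε) (hε1 : ε ≤ 1) :
    ∃ T : ℕ, 4 * (1 + T) < ε ^ 2 * 2 ^ T ∧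
      (2 : ℝ) ^ T ≤ 8 * (6 + 5 * Real.log (1 / ε)) / ε ^ 2 := by
  classical
  have hex := exists_four_mul_lt_mul_two_pow (pow_pos hε 2)
  refine ⟨Nat.find hex, Nat.find_spec hex, (le_div_iff₀ (by positivity)).2 ?_⟩
  rcases hT : Nat.find hex with _ | n
  · have hlog : 0 ≤ Real.log (1 / ε) := Real.log_nonneg ((one_le_div hε).2 hε1)
    rw [pow_zero]
    nlinarith
  · have hn : ε ^ 2 * 2 ^ n ≤ 4 * (1 + n) := not_lt.1 (Nat.find_min hex (by omega))
    have hle := add_one_le_of_sq_mul_two_pow_le hε hε1 hn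
    rw [pow_succ]
    linarith

end FirstSuitableRound

section Constants

variable {κ : ℝ}

lemma log_one_div_pos {y : ℝ} (hy : 0 < y) (hy1 : y < 1) : 0 < Real.log (1 / y) :=
  Real.log_pos ((one_lt_div hy).2 hy1)

lemma one_le_log_div_log {y : ℝ} (hy : 0 < y) (hyκ : y ≤ κ) (hκ1 : κ < 1) :
    1 ≤ Real.log (1 / y) / Real.log (1 / κ) :=
  (one_le_div (log_one_div_pos (hy.trans_le hyκ) hκ1)).2
    (Real.log_le_log (one_div_pos.2 (hy.trans_le hyκ)) (one_div_le_one_div_of_le hy hyκ))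

lemma roundSupergroups_zero_le {δ : ℝ} (hδ : 0 < δ) (hδκ : δ ≤ κ) (hκ1 : κ < 1) :
    (roundSupergroups δ 0 : ℝ) ≤ (7 / Real.log (1 / κ) + 8) * Real.log (1 / δ) := by
  have hlog := log_one_div_failProb hδ 0
  have hnonneg := log_one_div_pos hδ (hδκ.trans_lt hκ1)
  have hceil : (roundSupergroups δ 0 : ℝ) < 8 * Real.log (1 / failProb δ 0) + 1 :=
    Nat.ceil_lt_add_one (by
      rw [hlog]
      have := Real.log_two_gt_d9
      positivity)
  rw [hlog] at hceil
  push_cast at hceil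
  calc (roundSupergroups δ 0 : ℝ) ≤ 7 * 1 + 8 * Real.log (1 / δ) := by
        linarith [Real.log_two_lt_d9]
    _ ≤ 7 * (Real.log (1 / δ) / Real.log (1 / κ)) + 8 * Real.log (1 / δ) := by
        gcongr
        exact one_le_log_div_log hδ hδκ hκ1
    _ = _ := by ring

lemma one_le_exp_ratio {α : ℝ} (hα : 0 < α) : 1 ≤ (Real.exp α + 1) / (Real.exp α - 1) := by
  have := Real.add_one_lt_exp hα.ne'
  rw [le_div_iff₀ (by linarith)]
  linarith

lemma exp_ratio_sq_le {α : ℝ} (hα : 0 < α) (hα1 : α ≤ 1) :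
    ((Real.exp α + 1) / (Real.exp α - 1)) ^ 2 ≤ 16 / α ^ 2 := by
  have hlow := Real.add_one_lt_exp hα.ne'
  have hup : Real.exp α ≤ Real.exp 1 := Real.exp_le_exp.2 hα1
  calc _ ≤ (4 / α) ^ 2 := by
        refine pow_le_pow_left₀ (div_nonneg (by linarith) (by linarith)) ?_ 2
        exact div_le_div₀ (by norm_num) (by linarith [Real.exp_one_lt_d9]) hα (by linarith)
    _ = _ := by ring

lemma numSalts_le {α β : ℝ} (hα : 0 < α) (hβ : 0 < β) (hβκ : β ≤ κ) (hκ1 : κ < 1) :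
    (numSalts α β : ℝ) ≤ ((Real.exp α + 1) / (Real.exp α - 1)) ^ 2 *
      ((10 / Real.log (1 / κ) + 6) * Real.log (1 / β)) := by
  set E := (Real.exp α + 1) / (Real.exp α - 1)
  have hE : 1 ≤ E ^ 2 := one_le_pow₀ (one_le_exp_ratio hα)
  have hlog : Real.log (4 / β) = 2 * Real.log 2 + Real.log (1 / β) := by
    rw [show 4 / β = 2 ^ 2 * (1 / β) by ring, Real.log_mul (by norm_num) (by positivity),
      Real.log_pow, Nat.cast_ofNat]
  have hpos : 0 ≤ 6 * E ^ 2 * Real.log (4 / β) := by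
    have := log_one_div_pos hβ (hβκ.trans_lt hκ1)
    have := Real.log_two_gt_d9
    rw [hlog]
    positivity
  have hceil : (numSalts α β : ℝ) ≤ 6 * E ^ 2 * Real.log (4 / β) + 1 := by
    rw [numSalts, Nat.cast_max, Nat.cast_one]
    exact max_le (le_add_of_nonneg_left hpos) (Nat.ceil_lt_add_one hpos).le
  calc (numSalts α β : ℝ) ≤ E ^ 2 * (6 * Real.log (4 / β) + 1) := by linarith
    _ ≤ E ^ 2 * (10 * 1 + 6 * Real.log (1 / β)) :=
        mul_le_mul_of_nonneg_left (by linarith [Real.log_two_lt_d9]) (by positivity)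
    _ ≤ E ^ 2 * (10 * (Real.log (1 / β) / Real.log (1 / κ)) + 6 * Real.log (1 / β)) := by
        gcongr
        exact one_le_log_div_log hβ hβκ hκ1
    _ = _ := by ring

lemma six_add_five_mul_log_le {ε : ℝ} (hε : 0 < ε) (hεκ : ε ≤ κ) (hκ1 : κ < 1) :
    6 + 5 * Real.log (1 / ε) ≤
      (6 / Real.log (1 / κ) ^ 2 + 5 / Real.log (1 / κ)) * Real.log (1 / ε) ^ 2 := by
  have hpos : 0 < Real.log (1 / ε) := log_one_div_pos hε (hεκ.trans_lt hκ1)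
  have hone := one_le_log_div_log hε hεκ hκ1
  calc 6 + 5 * Real.log (1 / ε) = 6 * 1 ^ 2 + 5 * (1 * Real.log (1 / ε)) := by ring
    _ ≤ 6 * (Real.log (1 / ε) / Real.log (1 / κ)) ^ 2 +
        5 * (Real.log (1 / ε) / Real.log (1 / κ) * Real.log (1 / ε)) := by gcongr
    _ = _ := by ring

/-- The constant of the sample bound `sampleConst κ * E ^ 2 * log² (1/ε) log (1/β) log (1/δ) / ε²`
with `E = (exp α + 1) / (exp α - 1)`: the factors bound the first supergroup number, the number of
salts and the number of doublings relative to the logarithms. -/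
noncomputable def sampleConst (κ : ℝ) : ℝ :=
  1280 * (7 / Real.log (1 / κ) + 8) * (10 / Real.log (1 / κ) + 6) *
    (8 * (6 / Real.log (1 / κ) ^ 2 + 5 / Real.log (1 / κ)))

lemma sampleConst_pos (hκ : 0 < κ) (hκ1 : κ < 1) : 0 < sampleConst κ := by
  have := log_one_div_pos hκ hκ1
  unfold sampleConst
  positivity

lemma four_mul_expectedUsers_succ_le {α β δ ε : ℝ} (hκ1 : κ < 1) (hα : 0 < α) (hβ : 0 < β)
    (hβκ : β ≤ κ) (hδ : 0 < δ) (hδκ : δ ≤ κ) (hε : 0 < ε) (hεκ : ε ≤ κ) {T : ℕ}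
    (hT : (2 : ℝ) ^ T ≤ 8 * (6 + 5 * Real.log (1 / ε)) / ε ^ 2) :
    4 * expectedUsers α β δ (T + 1) ≤
      sampleConst κ * (((Real.exp α + 1) / (Real.exp α - 1)) ^ 2 *
        (Real.log (1 / ε) ^ 2 * Real.log (1 / β) * Real.log (1 / δ) / ε ^ 2)) := by
  have hL := log_one_div_pos (hε.trans_le hεκ) hκ1
  have hβpos := log_one_div_pos hβ (hβκ.trans_lt hκ1)
  have hδpos := log_one_div_pos hδ (hδκ.trans_lt hκ1)
  calc 4 * expectedUsers α β δ (T + 1)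
      ≤ 1280 * roundSupergroups δ 0 * numSalts α β * 2 ^ T := by
        linarith [expectedUsers_succ_le α β δ T]
    _ ≤ 1280 * ((7 / Real.log (1 / κ) + 8) * Real.log (1 / δ)) *
        (((Real.exp α + 1) / (Real.exp α - 1)) ^ 2 *
          ((10 / Real.log (1 / κ) + 6) * Real.log (1 / β))) *
        (8 * ((6 / Real.log (1 / κ) ^ 2 + 5 / Real.log (1 / κ)) * Real.log (1 / ε) ^ 2) /
          ε ^ 2) := by
        gcongr
        · exact roundSupergroups_zero_le hδ hδκ hκ1
        · exact numSalts_le hα hβ hβκ hκ1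
        · refine hT.trans ?_
          gcongr
          exact six_add_five_mul_log_le hε hεκ hκ1
    _ = _ := by
        unfold sampleConst
        ring

theorem ofReal_one_sub_le_measure_rejectsWithin_of_sampleConst_le {k : ℕ} (p : PMF (Fin k))
    {c₀ α β δ ε B : ℝ} (hκ1 : κ < 1) (hα : 0 < α) (hβ : 0 < β) (hβκ : β ≤ κ) (hδ : 0 < δ)
    (hδκ : δ ≤ κ) (hε : 0 < ε) (hεκ : ε ≤ κ) (h : ε ≤ |collisionProb p - c₀|)
    (hB : sampleConst κ * (((Real.exp α + 1) / (Real.exp α - 1)) ^ 2 *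
      (Real.log (1 / ε) ^ 2 * Real.log (1 / β) * Real.log (1 / δ) / ε ^ 2)) ≤ B) :
    ENNReal.ofReal (1 - δ) ≤ fullLaw p α β δ {ω | RejectsWithin c₀ α β δ B ω.2 ω.1} := by
  obtain ⟨T, hT, hTle⟩ := exists_four_mul_lt_and_two_pow_le hε (hεκ.trans hκ1.le)
  have hbound := four_mul_expectedUsers_succ_le hκ1 hα hβ hβκ hδ hδκ hε hεκ hTle
  exact (ofReal_one_sub_le_measure_rejectsWithin p hδ (hδκ.trans hκ1.le) hε h hT).trans
    (measure_mono fun ω hω => hω.mono (hbound.trans hB))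

end Constants

section MeasurabilityOfTheTranscript

variable {r k : ℕ}

lemma measurable_groupSum (j : ℕ) :
    Measurable fun T : RunTranscript r k => groupSum T j := by
  refine measurable_eval_at (f := fun (T : RunTranscript r k) n =>
    ∑ i ∈ Finset.range n, ((T.2.2 (j, i) : ℤ) : ℝ)) (measurable_pi_lambda _ fun n =>
      Finset.measurable_fun_sum _ fun i _ => ?_) (by fun_prop)
  exact (measurable_sign_apply (j, i)).comp (measurable_snd.comp measurable_snd)

lemma measurable_estimate (a b : ℕ) (m : ℝ) :
    Measurable (estimate a b m : RunTranscript r k → ℝ) := by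
  refine (measurable_median a).comp (measurable_pi_lambda _ fun l => ?_)
  refine (Finset.measurable_fun_sum _ fun j _ => ?_).const_mul _
  exact ((((measurable_groupSum _).pow_const 2).sub_const m).const_mul _).div_const _

/-- The rejection criterion of round `t` in terms of the transcript of this round alone. -/
def TranscriptExceeds (c₀ α β δ : ℝ) (t : ℕ) (T : RunTranscript (numSalts α β) k) : Prop :=
  radius α β δ t <
    |estimate (roundSupergroups δ t) (roundGroupsPer α β δ t) (roundRate α β δ t) T - c₀|

/-- The rejection in round `t` in terms of the transcripts of all rounds. -/
def TranscriptRejectsAt (c₀ α β δ : ℝ) (t : ℕ) (R : ℕ → RunTranscript (numSalts α β) k) : Prop :=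
  TranscriptExceeds c₀ α β δ t (R t) ∧ ∀ u < t, ¬ TranscriptExceeds c₀ α β δ u (R u)

open Classical in
/-- The transcript of the tester in terms of the transcripts `R` that its rounds would have if the
tester never stopped. -/
noncomputable def stoppedTranscript (c₀ α β δ : ℝ) (R : ℕ → RunTranscript (numSalts α β) k) :
    ℕ → Unit ⊕ RunTranscript (numSalts α β) k :=
  fun t => if ∃ u < t, TranscriptRejectsAt c₀ α β δ u R then Sum.inl () else Sum.inr (R t)

lemma transcript_eq_stoppedTranscript (c₀ α β δ : ℝ) (x : ℕ → Fin k)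
    (ω : Seed (numSalts α β) k) :
    transcript c₀ α β δ x ω = stoppedTranscript c₀ α β δ (roundTranscript α β δ x ω) := rfl

lemma measurable_transcriptExceeds (c₀ α β δ : ℝ) (t : ℕ) :
    Measurable (TranscriptExceeds (k := k) c₀ α β δ t) :=
  measurableSet_setOfPred.1
    (measurableSet_lt measurable_const ((measurable_estimate _ _ _).sub_const c₀).abs)

lemma measurable_transcriptRejectsAt (c₀ α β δ : ℝ) (t : ℕ) :
    Measurable (TranscriptRejectsAt (k := k) c₀ α β δ t) :=
  have hexc : ∀ u, Measurable fun R : ℕ → RunTranscript (numSalts α β) k =>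
      TranscriptExceeds c₀ α β δ u (R u) := fun u =>
    (measurable_transcriptExceeds c₀ α β δ u).comp (measurable_pi_apply u)
  (hexc t).and (.forall fun u => .imp measurable_const (hexc u).not)

lemma measurable_stoppedTranscript (c₀ α β δ : ℝ) :
    Measurable (stoppedTranscript (k := k) c₀ α β δ) :=
  measurable_pi_lambda _ fun t => Measurable.ite
    (measurableSet_setOfPred.2 (.exists fun u =>
      measurable_const.and (measurable_transcriptRejectsAt c₀ α β δ u)))
    measurable_const (measurable_inr.comp (measurable_pi_apply t))

lemma measurable_roundTranscript (α β δ : ℝ) (x : ℕ → Fin k) (t : ℕ) :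
    Measurable fun ω : Seed (numSalts α β) k => roundTranscript α β δ x ω t := by
  have hsize : ∀ j, Measurable fun ω : Seed (numSalts α β) k => ω.1 (t, j) := fun j => by fun_prop
  have hhash : Measurable fun (ω : Seed (numSalts α β) k) q => ω.2.1 (t, q) := by fun_prop
  have hsalt : Measurable fun (ω : Seed (numSalts α β) k) => ω.2.2 := by fun_prop
  refine Measurable.prodMk (measurable_pi_lambda _ fun j => ?_)
    (hhash.prodMk (measurable_pi_lambda _ fun q => ?_))
  · exact Measurable.ite (.const _) (hsize j) measurable_const
  · have huser : Measurable fun ω : Seed (numSalts α β) k =>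
        usersBefore α β δ ω t + member (fun j => ω.1 (t, j)) q.1 q.2 :=
      (measurable_usersBefore α β δ t).add (measurable_member _ _ (by fun_prop))
    have hx : Measurable x := .of_discrete
    refine Measurable.ite ((MeasurableSet.const _).inter
      (measurableSet_lt measurable_const (hsize q.1))) ?_ measurable_const
    exact measurable_eval_at hhash (measurable_const.prodMk
      ((measurable_eval_at hsalt huser).prodMk (hx.comp huser)))

lemma measurable_transcript (c₀ α β δ : ℝ) (x : ℕ → Fin k) :
    Measurable fun ω : Seed (numSalts α β) k => transcript c₀ α β δ x ω :=
  (measurable_stoppedTranscript c₀ α β δ).comp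
    (measurable_pi_lambda _ fun t => measurable_roundTranscript α β δ x t)

end MeasurabilityOfTheTranscript

section UserPositions

variable {k : ℕ}

/-- The number of users in the rounds before round `t`, in terms of the group sizes `N` alone:
privacy is shown for fixed group sizes. -/
noncomputable def firstUser (α β δ : ℝ) (N : ℕ × ℕ → ℕ) (t : ℕ) : ℕ :=
  ∑ u ∈ Finset.range t, ∑ j ∈ Finset.range (roundGroups α β δ u), N (u, j)

/-- User `i` takes part in group `j` of round `t`, if all rounds are run. -/
def IsMember (α β δ : ℝ) (N : ℕ × ℕ → ℕ) (i t j : ℕ) : Prop :=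
  j < roundGroups α β δ t ∧
    ∃ l < N (t, j), firstUser α β δ N t + member (fun j => N (t, j)) j l = i

lemma IsMember.firstUser_le {α β δ : ℝ} {N : ℕ × ℕ → ℕ} {i t j : ℕ}
    (h : IsMember α β δ N i t j) : firstUser α β δ N t ≤ i := by
  obtain ⟨-, l, -, rfl⟩ := h
  exact Nat.le_add_right _ _

lemma IsMember.lt_firstUser {α β δ : ℝ} {N : ℕ × ℕ → ℕ} {i t t' j : ℕ}
    (h : IsMember α β δ N i t j) (ht : t < t') : i < firstUser α β δ N t' := by
  obtain ⟨hj, l, hl, rfl⟩ := h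
  calc firstUser α β δ N t + member (fun j => N (t, j)) j l
      < firstUser α β δ N t + member (fun j => N (t, j)) (roundGroups α β δ t) 0 :=
        Nat.add_lt_add_left (member_lt_member _ hj hl) _
    _ = firstUser α β δ N (t + 1) := (Finset.sum_range_succ _ _).symm
    _ ≤ firstUser α β δ N t' := Finset.sum_le_sum_of_subset (Finset.range_subset_range.2 ht)

lemma IsMember.unique {α β δ : ℝ} {N : ℕ × ℕ → ℕ} {i t j t' j' : ℕ}
    (h : IsMember α β δ N i t j) (h' : IsMember α β δ N i t' j') : t = t' ∧ j = j' := by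
  rcases lt_trichotomy t t' with hlt | rfl | hlt
  · exact absurd (h.lt_firstUser hlt) h'.firstUser_le.not_gt
  · obtain ⟨-, l, hl, hi⟩ := h
    obtain ⟨-, l', hl', hi'⟩ := h'
    exact ⟨rfl, (member_inj _ hl hl' (Nat.add_left_cancel (hi.trans hi'.symm))).1⟩
  · exact absurd (h'.lt_firstUser hlt) h.firstUser_le.not_gt

lemma exists_forall_isMember (α β δ : ℝ) (N : ℕ × ℕ → ℕ) (i : ℕ) :
    ∃ t j, ∀ t' j', IsMember α β δ N i t' j' → t' = t ∧ j' = j := by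
  by_cases hex : ∃ t j, IsMember α β δ N i t j
  · obtain ⟨t, j, h⟩ := hex
    exact ⟨t, j, fun t' j' h' => h'.unique h⟩
  · exact ⟨0, 0, fun t' j' h' => absurd ⟨t', j', h'⟩ hex⟩

lemma transcript_congr (c₀ α β δ : ℝ) {x x' : ℕ → Fin k} {N : ℕ × ℕ → ℕ}
    {h : ℕ × ℕ × Fin (numSalts α β) × Fin k → ℤˣ} {s s' : ℕ → Fin (numSalts α β)} (i : ℕ)
    (hx : ∀ u, u ≠ i → x u = x' u) (hs : ∀ u, u ≠ i → s u = s' u)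
    (hi : ∀ t j, IsMember α β δ N i t j → h (t, j, s i, x i) = h (t, j, s' i, x' i)) :
    transcript c₀ α β δ x (N, h, s) = transcript c₀ α β δ x' (N, h, s') := by
  rw [transcript_eq_stoppedTranscript, transcript_eq_stoppedTranscript]
  congr 1
  ext1 t
  refine Prod.ext rfl (Prod.ext rfl (funext fun q => if_ctx_congr Iff.rfl (fun hq => ?_)
    fun _ => rfl))
  change h (t, q.1, s (firstUser α β δ N t + _), x (firstUser α β δ N t + _)) =
    h (t, q.1, s' (firstUser α β δ N t + _), x' (firstUser α β δ N t + _))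
  by_cases hu : firstUser α β δ N t + member (fun j => N (t, j)) q.1 q.2 = i
  · rw [hu]
    exact hi t q.1 ⟨hq.1, q.2, hq.2, hu⟩
  · rw [hx _ hu, hs _ hu]

end UserPositions

section LocalRandomizer

variable {V : Type*} [Fintype V] {α : ℝ}

/-- The signs `f` are so evenly distributed that sending `f v` for a uniform `v` is an
`α`-private randomizer among all sign families with this property. -/
def IsBalanced (α : ℝ) (f : V → ℤˣ) : Prop :=
  |∑ v, ((f v : ℤ) : ℝ)| ≤ (Real.exp α - 1) / (Real.exp α + 1) * Fintype.card V

lemma IsBalanced.card_add_mul_sum_le {f f' : V → ℤˣ} (hf : IsBalanced α f)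
    (hf' : IsBalanced α f') (u : ℤˣ) :
    Fintype.card V + ((u : ℤ) : ℝ) * ∑ v, ((f v : ℤ) : ℝ) ≤
      Real.exp α * (Fintype.card V + ((u : ℤ) : ℝ) * ∑ v, ((f' v : ℤ) : ℝ)) := by
  set τ := (Real.exp α - 1) / (Real.exp α + 1) with hτ
  have hratio : Real.exp α * (1 - τ) = 1 + τ := by
    rw [hτ]
    field_simp
    ring
  have hsum : ∀ {g : V → ℤˣ}, IsBalanced α g →
      |((u : ℤ) : ℝ) * ∑ v, ((g v : ℤ) : ℝ)| ≤ τ * Fintype.card V := fun hg => by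
    rwa [abs_mul, abs_sign, one_mul]
  calc _ ≤ Fintype.card V + τ * Fintype.card V := by
        linarith [(abs_le.1 (hsum hf)).2]
    _ = Real.exp α * (Fintype.card V + -(τ * Fintype.card V)) := by
        linear_combination -(Fintype.card V : ℝ) * hratio
    _ ≤ _ := by
        refine mul_le_mul_of_nonneg_left ?_ (Real.exp_pos α).le
        linarith [(abs_le.1 (hsum hf')).1]

lemma signLaw_not_isBalanced_le {Z : Type*} (g : V ↪ Z) (hα : 0 ≤ α) :
    (signLaw Z).real {h | ¬ IsBalanced α fun v => h (g v)} ≤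
      2 * Real.exp (-(((Real.exp α - 1) / (Real.exp α + 1)) ^ 2 * Fintype.card V / 2)) := by
  set τ := (Real.exp α - 1) / (Real.exp α + 1)
  have hτ0 : 0 ≤ τ := div_nonneg (by linarith [Real.one_le_exp hα]) (by positivity)
  have htail := signLaw_abs_sum_ge_le (Finset.univ.map g)
    (mul_nonneg hτ0 (Nat.cast_nonneg (Fintype.card V)))
  simp only [Finset.sum_map, Finset.card_map, Finset.card_univ] at htail
  refine (measureReal_mono fun h hh => ?_).trans (htail.trans_eq ?_)
  · exact (not_le.1 hh).le
  · congr 2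
    rcases eq_or_ne (Fintype.card V : ℝ) 0 with hV | hV
    · simp [hV]
    · field_simp

variable [MeasurableSpace V] [MeasurableSingletonClass V]

lemma uniformOn_real_preimage_sign (f : V → ℤˣ) (u : ℤˣ) :
    (uniformOn (Set.univ : Set V)).real (f ⁻¹' {u}) =
      (Fintype.card V + ((u : ℤ) : ℝ) * ∑ v, ((f v : ℤ) : ℝ)) / (2 * Fintype.card V) := by
  classical
  have hcount : (Measure.count (f ⁻¹' {u})).toReal =
      ∑ v, (1 + ((u : ℤ) : ℝ) * ((f v : ℤ) : ℝ)) / 2 := by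
    have hfilter : f ⁻¹' {u} = ((Finset.univ.filter fun v => f v = u : Finset V) : Set V) := by
      ext v
      simp
    rw [hfilter, Measure.count_apply_finset, ENNReal.toReal_natCast, Finset.card_filter,
      Nat.cast_sum]
    refine Finset.sum_congr rfl fun v _ => ?_
    rcases Int.units_eq_one_or (f v) with hv | hv <;>
      rcases Int.units_eq_one_or u with hu | hu <;> rw [hv, hu] <;> norm_num
  rw [Measure.real, uniformOn_univ, ENNReal.toReal_div, hcount, ← Finset.sum_div,
    Finset.sum_add_distrib, ← Finset.mul_sum, ENNReal.toReal_natCast]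
  simp only [Finset.sum_const, Finset.card_univ, nsmul_eq_mul, mul_one]
  rw [div_div]

lemma IsBalanced.uniformOn_preimage_le {f f' : V → ℤˣ} (hf : IsBalanced α f)
    (hf' : IsBalanced α f') (E : Set ℤˣ) :
    uniformOn (Set.univ : Set V) (f ⁻¹' E) ≤
      ENNReal.ofReal (Real.exp α) * uniformOn (Set.univ : Set V) (f' ⁻¹' E) := by
  classical
  rw [← E.toFinite.coe_toFinset, ← sum_measure_preimage_singleton _ fun _ _ => .of_discrete,
    ← sum_measure_preimage_singleton _ fun _ _ => .of_discrete, Finset.mul_sum]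
  refine Finset.sum_le_sum fun u _ => ?_
  rw [← ofReal_measureReal, ← ofReal_measureReal, ← ENNReal.ofReal_mul (Real.exp_pos α).le]
  refine ENNReal.ofReal_le_ofReal ?_
  rw [uniformOn_real_preimage_sign, uniformOn_real_preimage_sign, ← mul_div_assoc]
  gcongr
  exact hf.card_add_mul_sum_le hf' u

lemma IsBalanced.uniformOn_le {f f' : V → ℤˣ} (hf : IsBalanced α f) (hf' : IsBalanced α f')
    {A A' : Set V} (h : ∀ v ∈ A, ∀ v', f v = f' v' → v' ∈ A') :
    uniformOn (Set.univ : Set V) A ≤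
      ENNReal.ofReal (Real.exp α) * uniformOn (Set.univ : Set V) A' := by
  have hsub : f' ⁻¹' (f '' A) ⊆ A' := fun v' ⟨v, hv, hvv'⟩ => h v hv v' hvv'
  calc _ ≤ uniformOn (Set.univ : Set V) (f ⁻¹' (f '' A)) :=
        measure_mono (Set.subset_preimage_image f A)
    _ ≤ _ := hf.uniformOn_preimage_le hf' (f '' A)
    _ ≤ _ := by gcongr

end LocalRandomizer

section Privacy

variable {k : ℕ} {c₀ α β δ : ℝ}

lemma six_mul_log_le_ratio_sq_mul_numSalts (hα : 0 < α) : 6 * Real.log (4 / β) ≤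
    ((Real.exp α - 1) / (Real.exp α + 1)) ^ 2 * numSalts α β := by
  set τ := (Real.exp α - 1) / (Real.exp α + 1) with hτ
  have hτ0 : 0 < τ := div_pos (by linarith [Real.one_lt_exp_iff.2 hα]) (by positivity)
  have hceil : 6 * τ⁻¹ ^ 2 * Real.log (4 / β) ≤ numSalts α β := by
    rw [hτ, inv_div]
    exact (Nat.le_ceil _).trans (Nat.cast_le.2 (le_max_right _ _))
  calc 6 * Real.log (4 / β) = τ ^ 2 * (6 * τ⁻¹ ^ 2 * Real.log (4 / β)) := by field_simp
    _ ≤ _ := by gcongr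

lemma signLaw_not_isBalanced_row_le (hα : 0 < α) (hβ : 0 < β) (hβ1 : β ≤ 1) (t j : ℕ)
    (y : Fin k) :
    signLaw (ℕ × ℕ × Fin (numSalts α β) × Fin k)
      {h | ¬ IsBalanced α fun v => h (t, j, v, y)} ≤ ENNReal.ofReal (β / 2) := by
  have htail := signLaw_not_isBalanced_le (V := Fin (numSalts α β))
    ⟨fun v => (t, j, v, y), fun v v' h => by simpa using h⟩ hα.le
  rw [← ofReal_measureReal]
  refine ENNReal.ofReal_le_ofReal (htail.trans ?_)
  have hlog : 0 ≤ Real.log (4 / β) := Real.log_nonneg ((one_le_div hβ).2 (by linarith))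
  have hsalts := six_mul_log_le_ratio_sq_mul_numSalts (β := β) hα
  rw [Fintype.card_fin]
  calc _ ≤ 2 * Real.exp (-Real.log (4 / β)) := by
        gcongr
        linarith
    _ = β / 2 := by
        rw [Real.exp_neg, Real.exp_log (by positivity)]
        field_simp
        norm_num

lemma saltLaw_transcript_mem_le {x x' : ℕ → Fin k} (i : ℕ) (hx : ∀ u, u ≠ i → x' u = x u)
    {O : Set (ℕ → Unit ⊕ RunTranscript (numSalts α β) k)} (hO : MeasurableSet O)
    {N : ℕ × ℕ → ℕ} {h : ℕ × ℕ × Fin (numSalts α β) × Fin k → ℤˣ} {t j : ℕ}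
    (htj : ∀ t' j', IsMember α β δ N i t' j' → t' = t ∧ j' = j)
    (hb : IsBalanced α fun v => h (t, j, v, x i))
    (hb' : IsBalanced α fun v => h (t, j, v, x' i)) :
    saltLaw (numSalts α β) {s | transcript c₀ α β δ x (N, h, s) ∈ O} ≤
      ENNReal.ofReal (Real.exp α) *
        saltLaw (numSalts α β) {s | transcript c₀ α β δ x' (N, h, s) ∈ O} := by
  have hmeas : ∀ x : ℕ → Fin k, MeasurableSet {s | transcript c₀ α β δ x (N, h, s) ∈ O} :=
    fun x => ((measurable_transcript c₀ α β δ x).comp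
      (measurable_prodMk_left.comp measurable_prodMk_left)) hO
  unfold saltLaw
  rw [infinitePi_apply_eq_lintegral_update _ i (hmeas x),
    infinitePi_apply_eq_lintegral_update _ i (hmeas x'),
    ← lintegral_const_mul' _ _ ENNReal.ofReal_ne_top]
  refine lintegral_mono fun s => hb.uniformOn_le hb' fun v hv v' hvv' => ?_
  have hsame : transcript c₀ α β δ x (N, h, Function.update s i v) =
      transcript c₀ α β δ x' (N, h, Function.update s i v') := by
    refine transcript_congr c₀ α β δ i (fun u hu => (hx u hu).symm) (fun u hu => ?_)
      fun t' j' hm => ?_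
    · rw [Function.update_of_ne hu, Function.update_of_ne hu]
    · obtain ⟨rfl, rfl⟩ := htj t' j' hm
      rwa [Function.update_self, Function.update_self]
  change transcript c₀ α β δ x' (N, h, Function.update s i v') ∈ O
  rw [← hsame]
  exact hv

lemma signLaw_prod_saltLaw_transcript_mem_le (hα : 0 < α) (hβ : 0 < β) (hβ1 : β ≤ 1)
    {x x' : ℕ → Fin k} (i : ℕ) (hx : ∀ u, u ≠ i → x' u = x u)
    {O : Set (ℕ → Unit ⊕ RunTranscript (numSalts α β) k)} (hO : MeasurableSet O)
    (N : ℕ × ℕ → ℕ) :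
    (signLaw (ℕ × ℕ × Fin (numSalts α β) × Fin k)).prod (saltLaw (numSalts α β))
        {z | transcript c₀ α β δ x (N, z) ∈ O} ≤
      ENNReal.ofReal (Real.exp α) *
        (signLaw (ℕ × ℕ × Fin (numSalts α β) × Fin k)).prod (saltLaw (numSalts α β))
          {z | transcript c₀ α β δ x' (N, z) ∈ O} + ENNReal.ofReal β := by
  obtain ⟨t, j, htj⟩ := exists_forall_isMember α β δ N i
  set Unbalanced : Fin k → Set (ℕ × ℕ × Fin (numSalts α β) × Fin k → ℤˣ) := fun y =>
    {h | ¬ IsBalanced α fun v => h (t, j, v, y)} with hUnbalanced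
  have hmeas : ∀ x : ℕ → Fin k, MeasurableSet {z | transcript c₀ α β δ x (N, z) ∈ O} :=
    fun x => ((measurable_transcript c₀ α β δ x).comp measurable_prodMk_left) hO
  refine (measure_prod_le_mul_add_lintegral (hmeas x) (hmeas x')
    (c := ENNReal.ofReal (Real.exp α)) (f := (Unbalanced (x i) ∪ Unbalanced (x' i)).indicator 1)
    fun h => ?_).trans ?_
  · by_cases hh : h ∈ Unbalanced (x i) ∪ Unbalanced (x' i)
    · rw [Set.indicator_of_mem hh]
      exact prob_le_one.trans le_add_self
    · simp only [hUnbalanced, Set.mem_union, Set.mem_ofPred_eq, not_or, not_not] at hh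
      exact le_add_right (saltLaw_transcript_mem_le i hx hO htj hh.1 hh.2)
  · gcongr
    calc _ ≤ signLaw _ (Unbalanced (x i) ∪ Unbalanced (x' i)) := lintegral_indicator_one_le _
      _ ≤ ENNReal.ofReal (β / 2) + ENNReal.ofReal (β / 2) :=
        (measure_union_le _ _).trans (add_le_add
          (signLaw_not_isBalanced_row_le hα hβ hβ1 t j (x i))
          (signLaw_not_isBalanced_row_le hα hβ hβ1 t j (x' i)))
      _ = ENNReal.ofReal β := by
        rw [← ENNReal.ofReal_add (by positivity) (by positivity), add_halves]

theorem isLDP_transcript (hα : 0 < α) (hβ : 0 < β) (hβ1 : β ≤ 1) :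
    IsLDP α β (seedLaw k α β δ) (fun x ω => transcript c₀ α β δ x ω) := by
  intro i x x' hx O hO
  refine (measure_prod_le_mul_add_lintegral (measurable_transcript c₀ α β δ x hO)
    (measurable_transcript c₀ α β δ x' hO) (c := ENNReal.ofReal (Real.exp α))
    (f := fun _ => ENNReal.ofReal β)
    fun N => signLaw_prod_saltLaw_transcript_mem_le hα hβ hβ1 i hx hO N).trans_eq ?_
  rw [lintegral_const, measure_univ, mul_one]
  rfl

end Privacy

end CollisionTest

open CollisionTest in
theorem theorem7 :
    -- local differential privacy
    (∀ (k : ℕ) (c₀ α β δ : ℝ), 0 < α → 0 < β → β ≤ 1 → 0 < δ → δ ≤ 1 →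
      IsLDP α β (seedLaw k α β δ) (fun x ω => transcript c₀ α β δ x ω)) ∧
    -- under the null hypothesis the tester never rejects, with probability at least `1 - δ`
    (∀ (k : ℕ) (p : PMF (Fin k)) (c₀ α β δ : ℝ), 0 < α → 0 < β → β ≤ 1 → 0 < δ → δ ≤ 1 →
      collisionProb p = c₀ →
      ENNReal.ofReal (1 - δ) ≤
        fullLaw p α β δ {ω | ∀ t, ¬ RejectsAt c₀ α β δ ω.2 ω.1 t}) ∧
    -- under the alternative it rejects, and the number of samples is bounded
    (∀ κ : ℝ, 0 < κ → κ < 1 → ∃ K : ℝ, 0 < K ∧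
      ∀ (k : ℕ) (p : PMF (Fin k)) (c₀ α β δ ε : ℝ),
        0 < α → 0 < β → β ≤ κ → 0 < δ → δ ≤ κ → 0 < ε → ε ≤ κ →
        ε ≤ |collisionProb p - c₀| →
        ENNReal.ofReal (1 - δ) ≤ fullLaw p α β δ {ω | RejectsWithin c₀ α β δ
          (K * (((Real.exp α + 1) / (Real.exp α - 1)) ^ 2 *
            (Real.log (1 / ε) ^ 2 * Real.log (1 / β) * Real.log (1 / δ) / ε ^ 2))) ω.2 ω.1} ∧
        (α ≤ 1 → ENNReal.ofReal (1 - δ) ≤ fullLaw p α β δ {ω | RejectsWithin c₀ α β δ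
          (K * (Real.log (1 / ε) ^ 2 * Real.log (1 / β) * Real.log (1 / δ) /
            (α ^ 2 * ε ^ 2))) ω.2 ω.1})) := by
  refine ⟨fun k c₀ α β δ hα hβ hβ1 _ _ => isLDP_transcript hα hβ hβ1,
    fun k p c₀ α β δ _ _ _ hδ hδ1 h => h ▸ ofReal_one_sub_le_measure_never_rejects p hδ hδ1,
    fun κ hκ hκ1 => ?_⟩
  have hK := sampleConst_pos hκ hκ1
  refine ⟨16 * sampleConst κ, by positivity,
    fun k p c₀ α β δ ε hα hβ hβκ hδ hδκ hε hεκ h => ?_⟩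
  have hβ0 := log_one_div_nonneg hβ (hβκ.trans hκ1.le)
  have hδ0 := log_one_div_nonneg hδ (hδκ.trans hκ1.le)
  have hrej := fun B => ofReal_one_sub_le_measure_rejectsWithin_of_sampleConst_le p (B := B)
    hκ1 hα hβ hβκ hδ hδκ hε hεκ h
  refine ⟨hrej _ ?_, fun hα1 => hrej _ ?_⟩
  · gcongr
    linarith
  · calc _ ≤ sampleConst κ * (16 / α ^ 2 *
          (Real.log (1 / ε) ^ 2 * Real.log (1 / β) * Real.log (1 / δ) / ε ^ 2)) := by
          gcongr
          exact exp_ratio_sq_le hα hα1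
      _ = _ := by field_simp
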